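/- Let $G=C_3$ be a cyclic group of order $3$. All operads are symmetric operads in the category of $G$-sets, with composition $\gamma$ and unit $\mathbb 1$. Let $P_G$ be the operad with $P_G(n)=\{\text{functions } G\to\Sigma_n\}$, with right $\Sigma_n$-action $(f\cdot\sigma)(h)=f(h)\sigma$, left $G$-action $(a\cdot f)(h)=f(ha)$, unit the function constant at $1_{\Sigma_1}$, and composition, computed pointwise in $G$, given by the permuted block sums $\gamma(\sigma;\tau_1,\dots,\tau_n)=\sigma\langle k_1,\dots,k_n\rangle\cdot(\tau_1\oplus\cdots\oplus\tau_n)$ for $\tau_i\in\Sigma_{k_i}$. An element $f\in P_G(n)$ is primitive if $f(1_G)=1_{\Sigma_n}$. The norm of a finite ordered $G$-set $T$ is its permutation representation $\otimes_T\colon G\to\Sigma_{|T|}$, regarded as an element of $P_G(|T|)$. For a complete set $\mathfrak O$ of ordered $G$-orbits (a set of ordered nontrivial transitive $G$-sets containing exactly one of each isomorphism class, orderings being disregarded), $Q_{G,\mathfrak O}\subseteq P_G$ is the suboperad generated by the norms of the members of $\mathfrak O$, of $\varnothing$, and of the two-element ordered set with trivial action. For $G=C_3$, $\mathfrak O$ consists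 of a single ordered orbit with three elements; let $g$ be the generator of $G$ that acts on it as $(1\ 2\ 3)$. Write $Q_{C_3}=Q_{C_3,\mathfrak O}$. It is generated by $e\in Q_{C_3}(0)$, by $\otimes\in Q_{C_3}(2)$, the function constant at $1_{\Sigma_2}$, and by $\boxtimes\in Q_{C_3}(3)$, the function with $1\mapsto 1_{\Sigma_3}$, $g\mapsto(1\ 2\ 3)$, $g^2\mapsto(1\ 3\ 2)$. **Theorem.** Let $\mathbb F\{e,\otimes,\boxtimes\}$ be the free operad in $G$-sets on symbols $e,\otimes,\boxtimes$ of arities $0,2,3$ (its elements of arity $n$ are planar trees with $n$ leaves and with $k$-ary nodes labelled by pairs consisting of an element of $G$ and a symbol of arity $k$, together with an element of $\Sigma_n$), and let $\langle R\rangle$ be the smallest congruence relation on it that contains the following relations $R$: 1. Reduction to the identity: $\gamma(\boxtimes;\mathbb 1,e,e)=\gamma(\boxtimes;e,\mathbb 1,e)=\gamma(\boxtimes;e,e,\mathbb 1)=\gamma(\otimes;\mathbb 1,e)=\gamma(\otimes;e,\mathbb 1)=\mathbb 1$. 2. Strict associativity: $\gamma(\diamondsuit;\diamondsuit,\mathbb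 1)=\gamma(\diamondsuit;\mathbb 1,\diamondsuit)$ for each of the four binary operations $\diamondsuit\in\{\otimes,\ \gamma(\boxtimes;e,\mathbb 1,\mathbb 1),\ \gamma(\boxtimes;\mathbb 1,e,\mathbb 1),\ \gamma(\boxtimes;\mathbb 1,\mathbb 1,e)\}$. 3. Group action: $g\cdot\boxtimes=\boxtimes\cdot(1\ 2\ 3)$, $g\cdot\otimes=\otimes$, $g\cdot e=e$. Then there is an isomorphism of operads in $G$-sets $\mathbb F\{e,\otimes,\boxtimes\}/\langle R\rangle\cong Q_{C_3}$ that sends each of $e$, $\otimes$, $\boxtimes$ to its namesake. Moreover, the images under it of the four operations $\diamondsuit$ in (2) are exactly the primitive elements of $Q_{C_3}(2)$. -/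

import Mathlib

universe u v w

open Equiv

/-- Transport of an element of a graded family along an equality of degrees. -/
def castArity (X : ℕ → Type u) {m n : ℕ} (h : m = n) (x : X m) : X n := h ▸ x

/-! ### Block permutations -/

theorem sum_comp_symm {n : ℕ} (σ : Perm (Fin n)) (k : Fin n → ℕ) :
    ∑ j, k (σ.symm j) = ∑ i, k i :=
  Equiv.sum_comp σ.symm k

/-- The block permutation `σ⟨k₁, …, kₙ⟩`: it moves the `i`-th of the consecutive blocks of sizes
`k₁, …, kₙ` to the position `σ i`, without changing the order inside the blocks. -/
def blockPerm {n : ℕ} (σ : Perm (Fin n)) (k : Fin n → ℕ) : Perm (Fin (∑ i, k i)) :=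
  finSigmaFinEquiv.symm.trans <| (Equiv.sigmaCongrLeft' (β := fun i => Fin (k i)) σ).trans <|
    (finSigmaFinEquiv (n := fun j => k (σ.symm j))).trans (finCongr (sum_comp_symm σ k))

/-- The block sum `τ₁ ⊕ ⋯ ⊕ τₙ`. -/
def blockSum {n : ℕ} {k : Fin n → ℕ} (τ : ∀ i, Perm (Fin (k i))) : Perm (Fin (∑ i, k i)) :=
  finSigmaFinEquiv.symm.trans <| (Equiv.sigmaCongrRight τ).trans finSigmaFinEquiv

/-- The permuted block sum `σ⟨τ₁, …, τₙ⟩ = σ⟨k₁, …, kₙ⟩ · (τ₁ ⊕ ⋯ ⊕ τₙ)`. -/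
def permutedBlockSum {n : ℕ} (σ : Perm (Fin n)) {k : Fin n → ℕ} (τ : ∀ i, Perm (Fin (k i))) :
    Perm (Fin (∑ i, k i)) :=
  blockPerm σ k * blockSum τ

theorem finSigma_val {n : ℕ} {k : Fin n → ℕ} (i : Fin n) (a : Fin (k i)) :
    (finSigmaFinEquiv ⟨i, a⟩ : ℕ) = (∑ j, if j < i then k j else 0) + a := by
  rw [finSigmaFinEquiv_apply]
  congr 1
  rw [← Finset.sum_filter]
  refine Finset.sum_bij (fun x _ => Fin.castLE i.2.le x) ?_ ?_ ?_ ?_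
  · intro x _
    exact Finset.mem_filter.2 ⟨Finset.mem_univ _, x.2⟩
  · intro x _ y _ h
    simpa [Fin.ext_iff] using h
  · intro y hy
    simp only [Finset.mem_filter, Finset.mem_univ, true_and] at hy
    exact ⟨⟨y, hy⟩, Finset.mem_univ _, rfl⟩
  · intro x _
    rfl

theorem finSigma_cast {m n : ℕ} (h : m = n) {k : Fin n → ℕ} (h' : (∑ i, k (Fin.cast h i)) = ∑ i, k i)
    (i : Fin m) (a : Fin (k (Fin.cast h i))) :
    Fin.cast h' (finSigmaFinEquiv (n := fun i => k (Fin.cast h i)) ⟨i, a⟩) =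
      finSigmaFinEquiv ⟨Fin.cast h i, a⟩ := by
  subst h
  rfl

theorem exists_finSigma {n : ℕ} {k : Fin n → ℕ} (x : Fin (∑ i, k i)) :
    ∃ i, ∃ a : Fin (k i), x = finSigmaFinEquiv ⟨i, a⟩ :=
  ⟨(finSigmaFinEquiv.symm x).1, (finSigmaFinEquiv.symm x).2, by simp⟩

theorem sum_finSigma {n : ℕ} {k : Fin n → ℕ} (f : Fin (∑ i, k i) → ℕ) :
    ∑ x, f x = ∑ i, ∑ a : Fin (k i), f (finSigmaFinEquiv ⟨i, a⟩) := by
  rw [← Equiv.sum_comp finSigmaFinEquiv f, Fintype.sum_sigma]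

theorem finSigma_lt {n : ℕ} {k : Fin n → ℕ} (i j : Fin n) (a : Fin (k i)) (b : Fin (k j)) :
    (finSigmaFinEquiv ⟨i, a⟩ : Fin (∑ i, k i)) < finSigmaFinEquiv ⟨j, b⟩ ↔
      i < j ∨ ∃ h : i = j, (Fin.cast (congrArg k h) a) < b := by
  have key : ∀ (i j : Fin n) (a : Fin (k i)) (b : Fin (k j)), i < j →
      (finSigmaFinEquiv ⟨i, a⟩ : Fin (∑ i, k i)) < finSigmaFinEquiv ⟨j, b⟩ := by
    intro i j a b h
    rw [Fin.lt_def, finSigma_val, finSigma_val]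
    have h1 : (∑ l, if l < i then k l else 0) + k i ≤ ∑ l, if l < j then k l else 0 := by
      have : (∑ l, if l < i then k l else 0) + k i
          = ∑ l, ((if l < i then k l else 0) + if l = i then k l else 0) := by
        rw [Finset.sum_add_distrib]; simp
      rw [this]
      refine Finset.sum_le_sum fun l _ => ?_
      by_cases h2 : l < i
      · simp [h2, h2.ne, h2.trans h]
      · by_cases h3 : l = i
        · subst h3; simp [h]
        · simp [h2, h3]
    have := a.2
    omega
  rcases lt_trichotomy i j with h | h | h
  · simp [h, key i j a b h]
  · subst h
    rw [Fin.lt_def, finSigma_val, finSigma_val]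
    simp
  · have := key j i b a h
    simp only [h.not_gt, false_or]
    constructor
    · intro h'; exact absurd h' this.not_gt
    · rintro ⟨rfl, _⟩; exact absurd h (lt_irrefl _)

theorem blockPerm_apply {n : ℕ} (σ : Perm (Fin n)) (k : Fin n → ℕ) (i : Fin n) (a : Fin (k i)) :
    blockPerm σ k (finSigmaFinEquiv ⟨i, a⟩) = Fin.cast (sum_comp_symm σ k)
      (finSigmaFinEquiv (n := fun j => k (σ.symm j))
        ⟨σ i, Fin.cast (congrArg k (σ.symm_apply_apply i).symm) a⟩) := by
  have : (Equiv.sigmaCongrLeft' (β := fun i => Fin (k i)) σ) ⟨i, a⟩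
      = ⟨σ i, Fin.cast (congrArg k (σ.symm_apply_apply i).symm) a⟩ := by
    rw [Equiv.sigmaCongrLeft', Equiv.symm_apply_eq]
    simp only [Equiv.sigmaCongrLeft_apply]
    have : ∀ (j : Fin n) (h : i = j), (⟨i, a⟩ : Σ i, Fin (k i)) = ⟨j, Fin.cast (congrArg k h) a⟩ := by
      intro j h; subst h; rfl
    exact this _ (σ.symm_apply_apply i).symm
  simp [blockPerm, this]

theorem blockSum_apply {n : ℕ} {k : Fin n → ℕ} (τ : ∀ i, Perm (Fin (k i))) (i : Fin n)
    (a : Fin (k i)) :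
    blockSum τ (finSigmaFinEquiv ⟨i, a⟩) = finSigmaFinEquiv ⟨i, τ i a⟩ := by
  simp [blockSum]

theorem permutedBlockSum_apply {n : ℕ} (σ : Perm (Fin n)) {k : Fin n → ℕ}
    (τ : ∀ i, Perm (Fin (k i))) (i : Fin n) (a : Fin (k i)) :
    permutedBlockSum σ τ (finSigmaFinEquiv ⟨i, a⟩) = Fin.cast (sum_comp_symm σ k)
      (finSigmaFinEquiv (n := fun j => k (σ.symm j))
        ⟨σ i, Fin.cast (congrArg k (σ.symm_apply_apply i).symm) (τ i a)⟩) := by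
  rw [permutedBlockSum, Perm.mul_apply, blockSum_apply, blockPerm_apply]

theorem permutedBlockSum_val {n : ℕ} (σ : Perm (Fin n)) {k : Fin n → ℕ}
    (τ : ∀ i, Perm (Fin (k i))) (i : Fin n) (a : Fin (k i)) :
    (permutedBlockSum σ τ (finSigmaFinEquiv ⟨i, a⟩) : ℕ) =
      (∑ j, if σ j < σ i then k j else 0) + τ i a := by
  rw [permutedBlockSum_apply, Fin.val_cast, finSigma_val]
  congr 1
  rw [← Equiv.sum_comp σ]
  simp

theorem permutedBlockSum_one {n : ℕ} (σ : Perm (Fin n)) (k : Fin n → ℕ) :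
    permutedBlockSum σ (fun i => (1 : Perm (Fin (k i)))) = blockPerm σ k := by
  have : blockSum (fun i => (1 : Perm (Fin (k i)))) = 1 := by
    ext x
    obtain ⟨i, a, rfl⟩ := exists_finSigma x
    rw [blockSum_apply]; rfl
  rw [permutedBlockSum, this, mul_one]

theorem permutedBlockSum_lt {n : ℕ} (σ : Perm (Fin n)) {k : Fin n → ℕ}
    (τ : ∀ i, Perm (Fin (k i))) (i j : Fin n) (a : Fin (k i)) (b : Fin (k j)) :
    permutedBlockSum σ τ (finSigmaFinEquiv ⟨i, a⟩) < permutedBlockSum σ τ (finSigmaFinEquiv ⟨j, b⟩) ↔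
      σ i < σ j ∨ ∃ h : i = j, τ j (Fin.cast (congrArg k h) a) < τ j b := by
  rw [permutedBlockSum_apply, permutedBlockSum_apply, Fin.lt_def, Fin.val_cast, Fin.val_cast,
    ← Fin.lt_def, finSigma_lt]
  refine or_congr Iff.rfl ⟨?_, ?_⟩
  · rintro ⟨h, h'⟩
    obtain rfl := σ.injective h
    exact ⟨rfl, h'⟩
  · rintro ⟨rfl, h'⟩
    exact ⟨rfl, h'⟩

theorem castArity_perm_val {m n : ℕ} (h : m = n) (σ : Perm (Fin m)) (x : Fin n) :
    (castArity (fun n => Perm (Fin n)) h σ x : ℕ) = σ (Fin.cast h.symm x) := by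
  subst h; rfl

theorem finSigma_assoc {n : ℕ} {k : Fin n → ℕ} {l : Fin (∑ i, k i) → ℕ} (i : Fin n) (j : Fin (k i))
    (a : Fin (l (finSigmaFinEquiv ⟨i, j⟩))) :
    (finSigmaFinEquiv (n := fun i => ∑ j : Fin (k i), l (finSigmaFinEquiv ⟨i, j⟩))
      ⟨i, finSigmaFinEquiv (n := fun j => l (finSigmaFinEquiv ⟨i, j⟩)) ⟨j, a⟩⟩ : ℕ) =
    finSigmaFinEquiv (n := l) ⟨finSigmaFinEquiv ⟨i, j⟩, a⟩ := by
  rw [finSigma_val, finSigma_val, finSigma_val, ← add_assoc, sum_finSigma]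
  congr 1
  have : ∀ i', (∑ j' : Fin (k i'), if (finSigmaFinEquiv ⟨i', j'⟩ : Fin (∑ i, k i)) < finSigmaFinEquiv ⟨i, j⟩
        then l (finSigmaFinEquiv ⟨i', j'⟩) else 0)
      = (if i' < i then ∑ j : Fin (k i'), l (finSigmaFinEquiv ⟨i', j⟩) else 0) +
        if i' = i then ∑ j', if j' < j then l (finSigmaFinEquiv ⟨i, j'⟩) else 0 else 0 := by
    intro i'
    simp only [finSigma_lt]
    rcases lt_trichotomy i' i with h | h | h
    · simp [h, h.ne]
    · subst h; simp
    · simp [h.not_gt, h.ne']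
  simp only [this, Finset.sum_add_distrib]
  simp

theorem permutedBlockSum_assoc {n : ℕ} (σ : Perm (Fin n)) {k : Fin n → ℕ}
    (τ : ∀ i, Perm (Fin (k i))) {l : Fin (∑ i, k i) → ℕ} (ρ : ∀ x, Perm (Fin (l x))) :
    castArity (fun n => Perm (Fin n)) (sum_finSigma l)
      (permutedBlockSum (permutedBlockSum σ τ) ρ) =
    permutedBlockSum σ (fun i => permutedBlockSum (τ i) (fun j => ρ (finSigmaFinEquiv ⟨i, j⟩))) := by
  ext x
  obtain ⟨i, y, rfl⟩ := exists_finSigma x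
  obtain ⟨j, a, rfl⟩ := exists_finSigma y
  rw [castArity_perm_val]
  have hx : Fin.cast (sum_finSigma l).symm
      (finSigmaFinEquiv (n := fun i => ∑ j : Fin (k i), l (finSigmaFinEquiv ⟨i, j⟩))
      ⟨i, finSigmaFinEquiv (n := fun j => l (finSigmaFinEquiv ⟨i, j⟩)) ⟨j, a⟩⟩)
      = finSigmaFinEquiv (n := l) ⟨finSigmaFinEquiv ⟨i, j⟩, a⟩ :=
    Fin.ext (finSigma_assoc i j a)
  rw [hx, permutedBlockSum_val, permutedBlockSum_val, permutedBlockSum_val, ← add_assoc,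
    sum_finSigma]
  congr 1
  have : ∀ i', (∑ j' : Fin (k i'), if permutedBlockSum σ τ (finSigmaFinEquiv ⟨i', j'⟩) <
        permutedBlockSum σ τ (finSigmaFinEquiv ⟨i, j⟩)
        then l (finSigmaFinEquiv ⟨i', j'⟩) else 0)
      = (if σ i' < σ i then ∑ j : Fin (k i'), l (finSigmaFinEquiv ⟨i', j⟩) else 0) +
        if i' = i then ∑ j', if τ i j' < τ i j then l (finSigmaFinEquiv ⟨i, j'⟩) else 0 else 0 := by
    intro i'
    simp only [permutedBlockSum_lt]
    by_cases h : i' = i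
    · subst h; simp
    · by_cases h' : σ i' < σ i <;> simp [h, h']
  simp only [this, Finset.sum_add_distrib]
  simp

theorem permutedBlockSum_mul_left {n : ℕ} (ρ σ : Perm (Fin n)) {k : Fin n → ℕ}
    (τ : ∀ i, Perm (Fin (k i))) :
    permutedBlockSum (ρ * σ) τ =
      castArity (fun n => Perm (Fin n)) (sum_comp_symm σ k)
        (permutedBlockSum ρ (fun j => τ (σ.symm j))) * blockPerm σ k := by
  ext x
  obtain ⟨i, a, rfl⟩ := exists_finSigma x
  rw [Perm.mul_apply, castArity_perm_val, blockPerm_apply]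
  simp only [Fin.cast_cast, Fin.cast_eq_self]
  rw [permutedBlockSum_val, permutedBlockSum_val]
  congr 1
  · refine Eq.trans ?_ (Equiv.sum_comp σ _)
    simp
    rfl
  · have : ∀ (j : Fin n) (h : i = j), (τ i a : ℕ) = τ j (Fin.cast (congrArg k h) a) := by
      intro j h; subst h; rfl
    exact this _ (σ.symm_apply_apply i).symm

theorem permutedBlockSum_mul_right {n : ℕ} (σ : Perm (Fin n)) {k : Fin n → ℕ}
    (τ ρ : ∀ i, Perm (Fin (k i))) :
    permutedBlockSum σ (fun i => τ i * ρ i) = permutedBlockSum σ τ * blockSum ρ := by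
  ext x
  obtain ⟨i, a, rfl⟩ := exists_finSigma x
  rw [Perm.mul_apply, blockSum_apply, permutedBlockSum_val, permutedBlockSum_val]
  rfl

theorem sum_lt_one {n : ℕ} (x : Fin n) : (∑ j : Fin n, if j < x then 1 else 0) = (x : ℕ) := by
  rw [← Finset.sum_filter, Finset.sum_const, smul_eq_mul, mul_one, ← Fin.card_Iio x]
  congr 1
  ext y
  simp

theorem permutedBlockSum_one_right {n : ℕ} (σ : Perm (Fin n)) :
    castArity (fun n => Perm (Fin n)) (by simp)
      (permutedBlockSum σ (fun _ => (1 : Perm (Fin 1)))) = σ := by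
  ext x
  rw [castArity_perm_val]
  have hx : Fin.cast (by simp) x = finSigmaFinEquiv (n := fun _ : Fin n => 1) ⟨x, 0⟩ := by
    apply Fin.ext
    rw [finSigma_val]
    simp [sum_lt_one, -Finset.sum_boole]
  rw [hx, permutedBlockSum_val]
  rw [Equiv.sum_comp σ (fun j => if j < σ x then 1 else 0), sum_lt_one]
  simp

theorem permutedBlockSum_one_left {n : ℕ} (σ : Perm (Fin n)) :
    castArity (fun n => Perm (Fin n)) (by simp)
      (permutedBlockSum (1 : Perm (Fin 1)) (fun _ => σ)) = σ := by
  ext x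
  rw [castArity_perm_val]
  have hx : Fin.cast (by simp) x = finSigmaFinEquiv (n := fun _ : Fin 1 => n) ⟨0, x⟩ := by
    apply Fin.ext
    rw [finSigma_val]
    simp
  rw [hx, permutedBlockSum_val]
  simp

/-! ### Operads in sets and in `G`-sets -/

/-- A (symmetric) operad in sets: sets `obj n` with a right action of the symmetric group, a unit,
and compositions `γ : obj n × obj k₁ × ⋯ × obj kₙ → obj (k₁ + ⋯ + kₙ)`, subject to the
associativity, unit and equivariance axioms. -/
structure Operad where
  obj : ℕ → Type u
  act : ∀ {n : ℕ}, obj n → Perm (Fin n) → obj n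
  unit : obj 1
  comp : ∀ {n : ℕ}, obj n → ∀ {k : Fin n → ℕ}, (∀ i, obj (k i)) → obj (∑ i, k i)
  act_one : ∀ {n : ℕ} (f : obj n), act f 1 = f
  act_mul : ∀ {n : ℕ} (f : obj n) (σ τ : Perm (Fin n)), act f (σ * τ) = act (act f σ) τ
  comp_assoc : ∀ {n : ℕ} (f : obj n) {k : Fin n → ℕ} (h : ∀ i, obj (k i))
    {l : Fin (∑ i, k i) → ℕ} (p : ∀ x, obj (l x)),
    castArity obj (sum_finSigma l) (comp (comp f h) p) =
      comp f (fun i => comp (h i) (fun j => p (finSigmaFinEquiv ⟨i, j⟩)))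
  comp_unit : ∀ {n : ℕ} (f : obj n), castArity obj (by simp) (comp f (fun _ => unit)) = f
  unit_comp : ∀ {n : ℕ} (f : obj n), castArity obj (by simp) (comp unit (fun _ => f)) = f
  act_comp : ∀ {n : ℕ} (f : obj n) (σ : Perm (Fin n)) {k : Fin n → ℕ} (h : ∀ i, obj (k i)),
    comp (act f σ) h =
      act (castArity obj (sum_comp_symm σ k) (comp f (fun j => h (σ.symm j)))) (blockPerm σ k)
  comp_act : ∀ {n : ℕ} (f : obj n) {k : Fin n → ℕ} (h : ∀ i, obj (k i))
    (τ : ∀ i, Perm (Fin (k i))),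
    comp f (fun i => act (h i) (τ i)) = act (comp f h) (blockSum τ)

/-- An operad in `G`-sets: an operad in sets whose sets of operations carry left `G`-actions for
which all structure maps are equivariant and the unit is fixed. -/
structure GOperad (G : Type v) [Group G] extends Operad.{u} where
  smul : ∀ {n : ℕ}, G → obj n → obj n
  one_smul : ∀ {n : ℕ} (f : obj n), smul 1 f = f
  mul_smul : ∀ {n : ℕ} (a b : G) (f : obj n), smul (a * b) f = smul a (smul b f)
  smul_act : ∀ {n : ℕ} (a : G) (f : obj n) (σ : Perm (Fin n)),
    smul a (act f σ) = act (smul a f) σ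
  smul_unit : ∀ a : G, smul a unit = unit
  smul_comp : ∀ {n : ℕ} (a : G) (f : obj n) {k : Fin n → ℕ} (h : ∀ i, obj (k i)),
    smul a (comp f h) = comp (smul a f) (fun i => smul a (h i))

/-- The associativity operad `Assoc(n) = Σₙ`. -/
def Operad.assoc : Operad.{0} where
  obj n := Perm (Fin n)
  act σ τ := σ * τ
  unit := 1
  comp σ _ τ := permutedBlockSum σ τ
  act_one := mul_one
  act_mul f σ τ := (mul_assoc f σ τ).symm
  comp_assoc f _ h _ p := permutedBlockSum_assoc f h p
  comp_unit := permutedBlockSum_one_right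
  unit_comp := permutedBlockSum_one_left
  act_comp f σ _ h := permutedBlockSum_mul_left f σ h
  comp_act f _ h τ := permutedBlockSum_mul_right f h τ

theorem castArity_fun {X : ℕ → Type u} {G : Type v} {m n : ℕ} (h : m = n) (f : G → X m) (a : G) :
    castArity (fun n => G → X n) h f a = castArity X h (f a) := by
  subst h; rfl

/-- The operad in `G`-sets of all functions from `G` to an operad `O` in sets, with pointwise
operad structure, and with `G` acting by `(a · f) b = f (b a)`. -/
def Operad.functions (G : Type v) [Group G] (O : Operad.{u}) : GOperad.{max u v} G where
  obj n := G → O.obj n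
  act f σ := fun b => O.act (f b) σ
  unit := fun _ => O.unit
  comp f _ h := fun b => O.comp (f b) (fun i => h i b)
  act_one f := funext fun b => O.act_one (f b)
  act_mul f σ τ := funext fun b => O.act_mul (f b) σ τ
  comp_assoc f _ h _ p := funext fun b => by
    rw [castArity_fun]; exact O.comp_assoc (f b) (fun i => h i b) (fun x => p x b)
  comp_unit f := funext fun b => by rw [castArity_fun]; exact O.comp_unit (f b)
  unit_comp f := funext fun b => by rw [castArity_fun]; exact O.unit_comp (f b)
  act_comp f σ _ h := funext fun b => by
    rw [castArity_fun]; exact O.act_comp (f b) σ (fun i => h i b)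
  comp_act f _ h τ := funext fun b => O.comp_act (f b) (fun i => h i b) τ
  smul a f := fun b => f (b * a)
  one_smul f := funext fun b => by simp
  mul_smul a b f := funext fun c => by simp [mul_assoc]
  smul_act _ _ _ := rfl
  smul_unit _ := rfl
  smul_comp _ _ _ _ := rfl

/-- The operad `P_G` of objects of the `G`-equivariant Barratt–Eccles operad: its operations of
arity `n` are all functions `G → Σₙ`. -/
def PG (G : Type v) [Group G] : GOperad.{v} G := Operad.functions G Operad.assoc

/-- An element `f` of `P_G(n)` is primitive if `f(1) = 1`. -/
def PG.IsPrimitive {G : Type v} [Group G] {n : ℕ} (f : (PG G).obj n) : Prop :=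
  (show G → Perm (Fin n) from f) 1 = 1

namespace GOperad

variable {G : Type v} [Group G]

/-- A map of operads in `G`-sets. -/
structure Hom (O : GOperad.{u} G) (P : GOperad.{w} G) where
  toFun : ∀ {n : ℕ}, O.obj n → P.obj n
  map_act : ∀ {n : ℕ} (f : O.obj n) (σ : Perm (Fin n)), toFun (O.act f σ) = P.act (toFun f) σ
  map_smul : ∀ {n : ℕ} (a : G) (f : O.obj n), toFun (O.smul a f) = P.smul a (toFun f)
  map_unit : toFun O.unit = P.unit
  map_comp : ∀ {n : ℕ} (f : O.obj n) {k : Fin n → ℕ} (h : ∀ i, O.obj (k i)),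
    toFun (O.comp f h) = P.comp (toFun f) (fun i => toFun (h i))

/-- An isomorphism of operads in `G`-sets: a map of operads that is bijective in each arity. -/
structure Iso (O : GOperad.{u} G) (P : GOperad.{w} G) extends Hom O P where
  bijective : ∀ n : ℕ, Function.Bijective (toFun (n := n))

/-- The composition `γ(f; a, b)` with an operation `f` of arity two. -/
def comp₂ (O : GOperad.{u} G) (f : O.obj 2) {i j : ℕ} (a : O.obj i) (b : O.obj j) :
    O.obj (i + j) :=
  castArity O.obj (by simp) (O.comp f (k := ![i, j]) fun x => match x with
    | 0 => a
    | 1 => b)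

/-- The composition `γ(f; a, b, c)` with an operation `f` of arity three. -/
def comp₃ (O : GOperad.{u} G) (f : O.obj 3) {i j k : ℕ} (a : O.obj i) (b : O.obj j)
    (c : O.obj k) : O.obj (i + j + k) :=
  castArity O.obj (by simp [Fin.sum_univ_three]) (O.comp f (k := ![i, j, k]) fun x => match x with
    | 0 => a
    | 1 => b
    | 2 => c)

/-! ### Suboperads -/

theorem castArity_subtype {X : ℕ → Type u} (p : ∀ n, X n → Prop) {m n : ℕ} (h : m = n)
    (x : {x : X m // p m x}) :
    (castArity (fun n => {x : X n // p n x}) h x).1 = castArity X h x.1 := by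
  subst h; rfl

/-- A suboperad of an operad in `G`-sets. -/
structure Suboperad (O : GOperad.{u} G) where
  carrier : ∀ n : ℕ, Set (O.obj n)
  act_mem : ∀ {n : ℕ} {f : O.obj n} (σ : Perm (Fin n)), f ∈ carrier n → O.act f σ ∈ carrier n
  smul_mem : ∀ {n : ℕ} (a : G) {f : O.obj n}, f ∈ carrier n → O.smul a f ∈ carrier n
  unit_mem : O.unit ∈ carrier 1
  comp_mem : ∀ {n : ℕ} {f : O.obj n} {k : Fin n → ℕ} {h : ∀ i, O.obj (k i)},
    f ∈ carrier n → (∀ i, h i ∈ carrier (k i)) → O.comp f h ∈ carrier (∑ i, k i)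

/-- A suboperad is an operad in `G`-sets in its own right. -/
def Suboperad.toGOperad {O : GOperad.{u} G} (N : Suboperad O) : GOperad.{u} G where
  obj n := {f : O.obj n // f ∈ N.carrier n}
  act f σ := ⟨O.act f.1 σ, N.act_mem σ f.2⟩
  unit := ⟨O.unit, N.unit_mem⟩
  comp f _ h := ⟨O.comp f.1 (fun i => (h i).1), N.comp_mem f.2 (fun i => (h i).2)⟩
  smul a f := ⟨O.smul a f.1, N.smul_mem a f.2⟩
  act_one f := Subtype.ext (O.act_one f.1)
  act_mul f σ τ := Subtype.ext (O.act_mul f.1 σ τ)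
  comp_assoc f _ h _ p := Subtype.ext <| by
    rw [castArity_subtype]; exact O.comp_assoc f.1 (fun i => (h i).1) (fun x => (p x).1)
  comp_unit f := Subtype.ext <| by rw [castArity_subtype]; exact O.comp_unit f.1
  unit_comp f := Subtype.ext <| by rw [castArity_subtype]; exact O.unit_comp f.1
  act_comp f σ k h := Subtype.ext <| (O.act_comp f.1 σ (fun i => (h i).1)).trans <|
    congrArg (fun x => O.act x (blockPerm σ k)) (castArity_subtype (fun n x => x ∈ N.carrier n) (sum_comp_symm σ k)
      ⟨O.comp f.1 (fun j => (h (σ.symm j)).1), N.comp_mem f.2 (fun j => (h (σ.symm j)).2)⟩).symm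
  comp_act f _ h τ := Subtype.ext (O.comp_act f.1 (fun i => (h i).1) τ)
  one_smul f := Subtype.ext (O.one_smul f.1)
  mul_smul a b f := Subtype.ext (O.mul_smul a b f.1)
  smul_act a f σ := Subtype.ext (O.smul_act a f.1 σ)
  smul_unit a := Subtype.ext (O.smul_unit a)
  smul_comp a f _ h := Subtype.ext (O.smul_comp a f.1 (fun i => (h i).1))

/-- The suboperad generated by a sequence of subsets: the smallest suboperad containing them. -/
def suboperadGenerated (O : GOperad.{u} G) (S : ∀ n : ℕ, Set (O.obj n)) : Suboperad O where
  carrier n := {f | ∀ N : Suboperad O, (∀ m, S m ⊆ N.carrier m) → f ∈ N.carrier n}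
  act_mem σ hf N hN := N.act_mem σ (hf N hN)
  smul_mem a _ hf N hN := N.smul_mem a (hf N hN)
  unit_mem N _ := N.unit_mem
  comp_mem hf hh N hN := N.comp_mem (hf N hN) (fun i => hh i N hN)

/-! ### Congruence relations and quotients -/

/-- A congruence relation: a graded equivalence relation that respects both actions and the
operadic composition. -/
structure Congruence (O : GOperad.{u} G) where
  rel : ∀ n : ℕ, Setoid (O.obj n)
  act : ∀ {n : ℕ} {f f' : O.obj n} (σ : Perm (Fin n)),
    rel n f f' → rel n (O.act f σ) (O.act f' σ)
  smul : ∀ {n : ℕ} (a : G) {f f' : O.obj n}, rel n f f' → rel n (O.smul a f) (O.smul a f')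
  comp : ∀ {n : ℕ} {f f' : O.obj n} {k : Fin n → ℕ} {h h' : ∀ i, O.obj (k i)},
    rel n f f' → (∀ i, rel (k i) (h i) (h' i)) → rel (∑ i, k i) (O.comp f h) (O.comp f' h')

/-- The congruence relation `⟨R⟩` generated by a graded binary relation `R`: the smallest
congruence relation containing `R`. -/
def congruenceGenerated (O : GOperad.{u} G) (R : ∀ n : ℕ, O.obj n → O.obj n → Prop) :
    Congruence O where
  rel n :=
    { r := fun f f' => ∀ C : Congruence O, (∀ m x y, R m x y → C.rel m x y) → C.rel n f f'
      iseqv :=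
        { refl := fun f C _ => (C.rel n).refl f
          symm := fun h C hC => (C.rel n).symm (h C hC)
          trans := fun h h' C hC => (C.rel n).trans (h C hC) (h' C hC) } }
  act σ h C hC := C.act σ (h C hC)
  smul a _ _ h C hC := C.smul a (h C hC)
  comp h h' C hC := C.comp (h C hC) (fun i => h' i C hC)

theorem castArity_quotient {X : ℕ → Type u} (r : ∀ n, Setoid (X n)) {m n : ℕ} (h : m = n)
    (x : X m) :
    castArity (fun n => Quotient (r n)) h (Quotient.mk (r m) x) =
      Quotient.mk (r n) (castArity X h x) := by
  subst h; rfl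

namespace Congruence

variable {O : GOperad.{u} G} (C : Congruence O)

/-- The class of an operation modulo a congruence relation. -/
def cls {n : ℕ} (f : O.obj n) : Quotient (C.rel n) := Quotient.mk (C.rel n) f

/-- The composition induced on classes. -/
noncomputable def quotComp {n : ℕ} (f : Quotient (C.rel n)) {k : Fin n → ℕ}
    (h : ∀ i, Quotient (C.rel (k i))) : Quotient (C.rel (∑ i, k i)) :=
  C.cls (O.comp f.out (fun i => (h i).out))

theorem quotComp_mk {n : ℕ} (f : O.obj n) {k : Fin n → ℕ} (h : ∀ i, O.obj (k i)) :
    C.quotComp (C.cls f) (fun i => C.cls (h i)) = C.cls (O.comp f h) :=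
  Quotient.sound (C.comp (Quotient.mk_out f) (fun i => Quotient.mk_out (h i)))

theorem exists_mk {n : ℕ} (f : Quotient (C.rel n)) : ∃ f', f = C.cls f' :=
  ⟨f.out, (Quotient.out_eq f).symm⟩

theorem exists_mk_pi {m : ℕ} {k : Fin m → ℕ} (h : ∀ i, Quotient (C.rel (k i))) :
    ∃ h' : ∀ i, O.obj (k i), h = fun i => C.cls (h' i) :=
  ⟨fun i => (h i).out, funext fun i => (Quotient.out_eq (h i)).symm⟩

/-- The quotient of an operad in `G`-sets by a congruence relation. -/
noncomputable def quotient : GOperad.{u} G where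
  obj n := Quotient (C.rel n)
  act f σ := Quotient.map' (fun x => O.act x σ) (fun _ _ h => C.act σ h) f
  unit := C.cls O.unit
  comp f _ h := C.quotComp f h
  smul a f := Quotient.map' (fun x => O.smul a x) (fun _ _ h => C.smul a h) f
  act_one f := by
    obtain ⟨f, rfl⟩ := C.exists_mk f
    exact congrArg C.cls (O.act_one f)
  act_mul f σ τ := by
    obtain ⟨f, rfl⟩ := C.exists_mk f
    exact congrArg C.cls (O.act_mul f σ τ)
  comp_assoc f _ h _ p := by
    obtain ⟨f, rfl⟩ := C.exists_mk f
    obtain ⟨h, rfl⟩ := C.exists_mk_pi h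
    obtain ⟨p, rfl⟩ := C.exists_mk_pi p
    simp only [quotComp_mk]
    refine (castArity_quotient C.rel _ _).trans ?_
    exact congrArg C.cls (O.comp_assoc f h p)
  comp_unit f := by
    obtain ⟨f, rfl⟩ := C.exists_mk f
    rw [quotComp_mk]
    refine (castArity_quotient C.rel _ _).trans ?_
    exact congrArg C.cls (O.comp_unit f)
  unit_comp f := by
    obtain ⟨f, rfl⟩ := C.exists_mk f
    rw [quotComp_mk]
    refine (castArity_quotient C.rel _ _).trans ?_
    exact congrArg C.cls (O.unit_comp f)
  act_comp f σ k h := by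
    obtain ⟨f, rfl⟩ := C.exists_mk f
    obtain ⟨h, rfl⟩ := C.exists_mk_pi h
    have h1 : Quotient.map' (fun x => O.act x σ) (fun _ _ h => C.act σ h) (C.cls f)
        = C.cls (O.act f σ) := rfl
    rw [h1, quotComp_mk, quotComp_mk C f (fun j => h (σ.symm j)), O.act_comp]
    have h2 := castArity_quotient C.rel (sum_comp_symm σ k) (O.comp f (fun j => h (σ.symm j)))
    exact (congrArg (Quotient.map' (fun x => O.act x (blockPerm σ k))
      (fun _ _ h => C.act _ h)) h2).symm
  comp_act f _ h τ := by
    obtain ⟨f, rfl⟩ := C.exists_mk f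
    obtain ⟨h, rfl⟩ := C.exists_mk_pi h
    rw [quotComp_mk]
    exact (C.quotComp_mk f (fun i => O.act (h i) (τ i))).trans (congrArg C.cls (O.comp_act f h τ))
  one_smul f := by
    obtain ⟨f, rfl⟩ := C.exists_mk f
    exact congrArg C.cls (O.one_smul f)
  mul_smul a b f := by
    obtain ⟨f, rfl⟩ := C.exists_mk f
    exact congrArg C.cls (O.mul_smul a b f)
  smul_act a f σ := by
    obtain ⟨f, rfl⟩ := C.exists_mk f
    exact congrArg C.cls (O.smul_act a f σ)
  smul_unit a := congrArg C.cls (O.smul_unit a)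
  smul_comp a f _ h := by
    obtain ⟨f, rfl⟩ := C.exists_mk f
    obtain ⟨h, rfl⟩ := C.exists_mk_pi h
    rw [quotComp_mk]
    exact (congrArg C.cls (O.smul_comp a f h)).trans
      (C.quotComp_mk (O.smul a f) (fun i => O.smul a (h i))).symm

end Congruence

end GOperad

/-! ### Free operads in `G`-sets -/

/-- Finite rooted planar trees whose nodes with `n` inputs are labelled by elements of `L n`. -/
inductive PlanarTree (L : ℕ → Type u) : Type u
  | leaf : PlanarTree L
  | node {n : ℕ} (a : L n) (t : Fin n → PlanarTree L) : PlanarTree L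

namespace PlanarTree

variable {L : ℕ → Type u}

/-- The number of leaves. A node without inputs is not a leaf. -/
def leaves : PlanarTree L → ℕ
  | leaf => 1
  | node _ t => ∑ i, (t i).leaves

/-- Grafting trees onto the leaves of a tree. The leaves are numbered from left to right. -/
def graft : (t : PlanarTree L) → (Fin t.leaves → PlanarTree L) → PlanarTree L
  | leaf, s => s (0 : Fin 1)
  | node a t, s => node a fun i => (t i).graft fun j => s (finSigmaFinEquiv ⟨i, j⟩)

/-- Relabelling the nodes of a tree. -/
def map (φ : ∀ {n : ℕ}, L n → L n) : PlanarTree L → PlanarTree L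
  | leaf => leaf
  | node a t => node (φ a) fun i => (t i).map φ

theorem leaves_graft : ∀ (t : PlanarTree L) (s : Fin t.leaves → PlanarTree L),
    (t.graft s).leaves = ∑ i, (s i).leaves
  | leaf, s => by
    show (s (0 : Fin 1)).leaves = ∑ i : Fin 1, (s i).leaves
    simp
  | node _ t, s =>
    (Finset.sum_congr rfl fun i _ => leaves_graft (t i) _).trans
      (sum_finSigma (k := fun i => (t i).leaves) fun x => (s x).leaves).symm

theorem graft_leaf : ∀ t : PlanarTree L, t.graft (fun _ => leaf) = t
  | leaf => rfl
  | node a t => congrArg (node a) (funext fun i => graft_leaf (t i))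

theorem leaves_map (φ : ∀ {n : ℕ}, L n → L n) : ∀ t : PlanarTree L, (t.map φ).leaves = t.leaves
  | leaf => rfl
  | node _ t => Finset.sum_congr rfl fun i _ => leaves_map φ (t i)

theorem graft_congr {t t' : PlanarTree L} (h : t = t') (s : Fin t.leaves → PlanarTree L)
    (s' : Fin t'.leaves → PlanarTree L)
    (hs : ∀ i, s i = s' (Fin.cast (congrArg leaves h) i)) : t.graft s = t'.graft s' := by
  subst h
  exact congrArg _ (funext hs)

theorem finSigma_cast_snd {n : ℕ} {k k' : Fin n → ℕ} (h : ∀ i, k i = k' i)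
    (h' : ∑ i, k i = ∑ i, k' i) (i : Fin n) (a : Fin (k i)) :
    Fin.cast h' (finSigmaFinEquiv ⟨i, a⟩) = finSigmaFinEquiv ⟨i, Fin.cast (h i) a⟩ := by
  obtain rfl : k = k' := funext h
  rfl

theorem map_graft (φ : ∀ {n : ℕ}, L n → L n) : ∀ (t : PlanarTree L)
    (s : Fin t.leaves → PlanarTree L),
    (t.graft s).map φ = (t.map φ).graft fun i => (s (Fin.cast (leaves_map φ t) i)).map φ
  | leaf, s => rfl
  | node a t, s => by
    refine congrArg (node (φ a)) (funext fun i => ?_)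
    refine (map_graft φ (t i) _).trans (congrArg _ (funext fun j => ?_))
    refine congrArg (fun x => (s x).map φ) ?_
    exact (finSigma_cast_snd (fun i => leaves_map φ (t i)) _ i j).symm

theorem graft_graft : ∀ (t : PlanarTree L) (s : Fin t.leaves → PlanarTree L)
    (p : Fin (t.graft s).leaves → PlanarTree L),
    (t.graft s).graft p = t.graft fun i => (s i).graft fun j =>
      p (Fin.cast (leaves_graft t s).symm (finSigmaFinEquiv ⟨i, j⟩))
  | leaf, s, p => by
    show (s (0 : Fin 1)).graft p = (s (0 : Fin 1)).graft _
    refine congrArg _ (funext fun j => congrArg p (Fin.ext ?_))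
    refine Eq.symm ((finSigma_val (n := 1) (k := fun i => (s i).leaves) 0 j).trans ?_)
    simp
  | node a t, s, p => by
    refine congrArg (node a) (funext fun i => ?_)
    refine (graft_graft (t i) _ _).trans (congrArg _ (funext fun j => ?_))
    refine congrArg _ (funext fun l => congrArg p (Fin.ext ?_))
    refine Eq.trans ?_
      (finSigma_assoc (k := fun i => (t i).leaves) (l := fun x => (s x).leaves) i j l)
    have := finSigma_cast_snd (k := fun i => ((t i).graft fun j => s (finSigmaFinEquiv ⟨i, j⟩)).leaves)
      (fun i => leaves_graft (t i) fun j => s (finSigmaFinEquiv ⟨i, j⟩))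
      (Finset.sum_congr rfl fun i _ => leaves_graft (t i) _) i
      (Fin.cast (leaves_graft (t i) _).symm (finSigmaFinEquiv ⟨j, l⟩))
    exact congrArg Fin.val this

theorem map_map (φ ψ : ∀ {n : ℕ}, L n → L n) : ∀ t : PlanarTree L,
    (t.map ψ).map φ = t.map (fun a => φ (ψ a))
  | leaf => rfl
  | node _ t => congrArg (node _) (funext fun i => map_map φ ψ (t i))

theorem map_id : ∀ t : PlanarTree L, t.map (fun a => a) = t
  | leaf => rfl
  | node _ t => congrArg (node _) (funext fun i => map_id (t i))

end PlanarTree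

theorem castArity_pair {X : ℕ → Type u} {Y : ℕ → Type v} {m n : ℕ} (h : m = n) (x : X m × Y m) :
    castArity (fun n => X n × Y n) h x = (castArity X h x.1, castArity Y h x.2) := by
  subst h; rfl

theorem castArity_tree {L : ℕ → Type u} {m n : ℕ} (h : m = n)
    (x : {t : PlanarTree L // t.leaves = m}) :
    (castArity (fun n => {t : PlanarTree L // t.leaves = n}) h x).1 = x.1 := by
  subst h; rfl

theorem permutedBlockSum_symm_apply {n : ℕ} (σ : Perm (Fin n)) {k : Fin n → ℕ}
    (τ : ∀ i, Perm (Fin (k i))) (i : Fin n) (a : Fin (k (σ.symm i))) :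
    (permutedBlockSum σ τ).symm (Fin.cast (sum_comp_symm σ k)
      (finSigmaFinEquiv (n := fun j => k (σ.symm j)) ⟨i, a⟩)) =
      finSigmaFinEquiv ⟨σ.symm i, (τ (σ.symm i)).symm a⟩ := by
  rw [Equiv.symm_apply_eq, permutedBlockSum_apply]
  congr 1
  have : ∀ (j : Fin n) (h : i = j), (finSigmaFinEquiv (n := fun j => k (σ.symm j)) ⟨i, a⟩)
      = finSigmaFinEquiv (n := fun j => k (σ.symm j)) ⟨j, Fin.cast (by rw [h]) a⟩ := by
    intro j h; subst h; rfl
  rw [this _ (σ.apply_symm_apply i).symm]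
  simp

/-- The free operad in `G`-sets on a sequence `S` of sets. An operation of arity `n` is a planar
tree with `n` leaves whose nodes with `k` inputs are labelled by `G × S k`, together with an
element of `Σₙ`; the pair `(t, σ)` stands for `t · σ`. Composition grafts trees and composes the
permutations, and `G` multiplies the `G`-label of each node. -/
def freeOperad (G : Type v) [Group G] (S : ℕ → Type u) : GOperad.{max u v} G where
  obj n := {t : PlanarTree (fun k => G × S k) // t.leaves = n} × Perm (Fin n)
  act x σ := (x.1, x.2 * σ)
  unit := (⟨PlanarTree.leaf, rfl⟩, 1)
  comp x k h :=
    (⟨x.1.1.graft fun i => (h (x.2.symm (Fin.cast x.1.2 i))).1.1, by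
        rw [PlanarTree.leaves_graft]
        simp only [(h _).1.2]
        exact (Equiv.sum_comp (finCongr x.1.2) (fun j => k (x.2.symm j))).trans
          (sum_comp_symm x.2 k)⟩,
      permutedBlockSum x.2 fun i => (h i).2)
  smul a x := (⟨x.1.1.map (fun b => (a * b.1, b.2)), by rw [PlanarTree.leaves_map, x.1.2]⟩, x.2)
  act_one x := by simp
  act_mul x σ τ := by simp [mul_assoc]
  comp_assoc := by
    rintro n ⟨⟨t, rfl⟩, σ⟩ k h l p
    refine Prod.ext (Subtype.ext ?_) ?_
    · rw [castArity_pair, castArity_tree]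
      refine (PlanarTree.graft_graft _ _ _).trans (congrArg _ (funext fun i => ?_))
      refine congrArg _ (funext fun j => ?_)
      have h1 := permutedBlockSum_symm_apply σ (fun i => (h i).2) i
        (Fin.cast (h (σ.symm i)).1.2 j)
      refine congrArg (fun x => (p x).1.1) (Eq.trans (congrArg _ (Fin.ext ?_)) h1)
      have h2 := congrArg Fin.val (PlanarTree.finSigma_cast_snd
        (fun i => (h (σ.symm i)).1.2) (Finset.sum_congr rfl fun i _ => (h (σ.symm i)).1.2) i j)
      exact h2
    · rw [castArity_pair]
      exact permutedBlockSum_assoc σ _ _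
  comp_unit := by
    rintro n ⟨⟨t, rfl⟩, σ⟩
    refine Prod.ext (Subtype.ext ?_) ?_
    · rw [castArity_pair, castArity_tree]
      exact PlanarTree.graft_leaf t
    · rw [castArity_pair]
      exact permutedBlockSum_one_right σ
  unit_comp := by
    rintro n ⟨⟨t, rfl⟩, σ⟩
    refine Prod.ext (Subtype.ext ?_) ?_
    · rw [castArity_pair, castArity_tree]
      rfl
    · rw [castArity_pair]
      exact permutedBlockSum_one_left σ
  act_comp := by
    rintro n ⟨⟨t, rfl⟩, ρ⟩ σ k h
    refine Prod.ext (Subtype.ext ?_) ?_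
    · rw [castArity_pair, castArity_tree]
      rfl
    · rw [castArity_pair]
      exact permutedBlockSum_mul_left ρ σ _
  comp_act x _ h τ := Prod.ext rfl (permutedBlockSum_mul_right x.2 (fun i => (h i).2) τ)
  one_smul x := by
    refine Prod.ext (Subtype.ext ?_) rfl
    simp only [one_mul]
    exact PlanarTree.map_id x.1.1
  mul_smul a b x := by
    refine Prod.ext (Subtype.ext ?_) rfl
    simp only [mul_assoc]
    exact (PlanarTree.map_map (fun b => (a * b.1, b.2)) (fun c => (b * c.1, c.2)) x.1.1).symm
  smul_act _ _ _ := rfl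
  smul_unit _ := rfl
  smul_comp a x _ h := Prod.ext (Subtype.ext (PlanarTree.map_graft _ x.1.1 _)) rfl

/-- The generator of the free operad given by an element `s` of `S n`: the tree with a single
node, labelled by `(1, s)`. -/
def freeOperad.gen {G : Type v} [Group G] {S : ℕ → Type u} {n : ℕ} (s : S n) :
    (freeOperad G S).obj n :=
  (⟨PlanarTree.node (1, s) (fun _ => PlanarTree.leaf), by simp [PlanarTree.leaves]⟩, 1)

/-! ### The operads `Q_G` -/

/-- Finite ordered `G`-sets with `n` elements are given by actions of `G` on `Fin n`, that is, by
homomorphisms `G →* Σₙ`. This predicate expresses that the action is transitive and that the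
`G`-set is not a single fixed point. -/
def IsNontrivialOrbit {G : Type v} [Group G] {n : ℕ} (ρ : G →* Perm (Fin n)) : Prop :=
  1 < n ∧ ∀ x y : Fin n, ∃ a : G, ρ a x = y

/-- Two ordered `G`-sets with `n` elements are isomorphic as `G`-sets, forgetting the ordering. -/
def IsomorphicGSets {G : Type v} [Group G] {n : ℕ} (ρ ρ' : G →* Perm (Fin n)) : Prop :=
  ∃ e : Fin n ≃ Fin n, ∀ (a : G) (x : Fin n), e (ρ a x) = ρ' a (e x)

/-- A complete set of ordered `G`-orbits: a set of ordered nontrivial transitive finite `G`-sets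
that contains exactly one representative of each isomorphism class. -/
structure IsCompleteOrbits {G : Type v} [Group G] (T : ∀ n : ℕ, Set (G →* Perm (Fin n))) :
    Prop where
  isNontrivialOrbit : ∀ (n : ℕ), ∀ ρ ∈ T n, IsNontrivialOrbit ρ
  existsUnique : ∀ (n : ℕ) (ρ : G →* Perm (Fin n)), IsNontrivialOrbit ρ →
    ∃! ρ' : G →* Perm (Fin n), ρ' ∈ T n ∧ IsomorphicGSets ρ ρ'

/-- The external norm of an ordered `G`-set: its permutation representation, as an element of
`P_G(n)`. -/
def PG.norm {G : Type v} [Group G] {n : ℕ} (ρ : G →* Perm (Fin n)) : (PG G).obj n :=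
  fun a => (ρ a : Perm (Fin n))

/-- The operad `Q_{G,T}`: the suboperad of `P_G` generated by the norms of the ordered `G`-sets in
`T`, of the empty `G`-set and of the two-element `G`-set with trivial action. -/
def QG (G : Type v) [Group G] (T : ∀ n : ℕ, Set (G →* Perm (Fin n))) : GOperad.{v} G :=
  ((PG G).suboperadGenerated fun n =>
    {f | ∃ ρ : G →* Perm (Fin n), (ρ ∈ T n ∨ (n = 0 ∨ n = 2) ∧ ρ = 1) ∧ f = PG.norm ρ}).toGOperad

/-- The inclusion of `Q_{G,T}` into `P_G`. -/
def QG.toPG {G : Type v} [Group G] {T : ∀ n : ℕ, Set (G →* Perm (Fin n))} {n : ℕ}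
    (f : (QG G T).obj n) : (PG G).obj n :=
  f.1

/-! ### The presentation for the cyclic group of order three -/

/-- The generating symbols `e`, `⊗` and `⊠`, of arities `0`, `2` and `3`. -/
inductive C3Gen : ℕ → Type
  | e : C3Gen 0
  | tensor : C3Gen 2
  | box : C3Gen 3

namespace C3

variable (G : Type v) [Group G]

/-- The free operad in `G`-sets on `e`, `⊗` and `⊠`. -/
abbrev F : GOperad.{v} G := freeOperad G C3Gen

/-- The generator `e` of the free operad. -/
def e : (F G).obj 0 := freeOperad.gen C3Gen.e

/-- The generator `⊗` of the free operad. -/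
def tensor : (F G).obj 2 := freeOperad.gen C3Gen.tensor

/-- The generator `⊠` of the free operad. -/
def box : (F G).obj 3 := freeOperad.gen C3Gen.box

/-- The four primitive binary operations `⊗`, `γ(⊠; e, 𝟙, 𝟙)`, `γ(⊠; 𝟙, e, 𝟙)` and
`γ(⊠; 𝟙, 𝟙, e)`, as elements of the free operad. -/
inductive IsBinaryNode : (F G).obj 2 → Prop
  | tensor : IsBinaryNode (tensor G)
  | box₁ : IsBinaryNode ((F G).comp₃ (box G) (e G) (F G).unit (F G).unit)
  | box₂ : IsBinaryNode ((F G).comp₃ (box G) (F G).unit (e G) (F G).unit)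
  | box₃ : IsBinaryNode ((F G).comp₃ (box G) (F G).unit (F G).unit (e G))

/-- The relations of the presentation, for a chosen generator `g` of the group: reduction to the
identity, strict associativity, and the group action. -/
inductive Rel (g : G) : ∀ n : ℕ, (F G).obj n → (F G).obj n → Prop
  | box_unit₁ : Rel g 1 ((F G).comp₃ (box G) (F G).unit (e G) (e G)) (F G).unit
  | box_unit₂ : Rel g 1 ((F G).comp₃ (box G) (e G) (F G).unit (e G)) (F G).unit
  | box_unit₃ : Rel g 1 ((F G).comp₃ (box G) (e G) (e G) (F G).unit) (F G).unit
  | tensor_unit₁ : Rel g 1 ((F G).comp₂ (tensor G) (F G).unit (e G)) (F G).unit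
  | tensor_unit₂ : Rel g 1 ((F G).comp₂ (tensor G) (e G) (F G).unit) (F G).unit
  | assoc (d : (F G).obj 2) (hd : IsBinaryNode G d) :
      Rel g 3 ((F G).comp₂ d d (F G).unit) ((F G).comp₂ d (F G).unit d)
  | smul_box : Rel g 3 ((F G).smul g (box G)) ((F G).act (box G) c[(0 : Fin 3), 1, 2])
  | smul_tensor : Rel g 2 ((F G).smul g (tensor G)) (tensor G)
  | smul_e : Rel g 0 ((F G).smul g (e G)) (e G)

/-- The congruence relation generated by the relations of the presentation. -/
def congr (g : G) : GOperad.Congruence (F G) := (F G).congruenceGenerated (Rel G g)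

end C3

/-! An element of `P_G(n)` is a family of linear orders on the `n` inputs, one for each `b` in `G`.
An operation of the free operad is a term with each input occurring once, and its image in `P_G` at
`b` is the list `ord b` of its variables, read off after permuting the children of each node
labelled `(a, s)` by the permutation of `s` at `b * a`. The operadic congruence becomes an
equational theory `Equi` on terms (`equi_of_rel`, `Equi.congrRel`, `rel_of_congrRel`). So the
isomorphism amounts to two facts: the image is `Q_G`, and terms without repeated variables are
equivalent exactly when they have the same lists for every `b`.

Soundness is `Equi.ord_eq`. Completeness, `equi_of_ord_eq`, goes by induction on the number of
variables. Every term is equivalent to a reduced one (`reducible`): `e`, a variable, one of the four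
binary operations applied to two terms that contain variables, or `⊠` applied to three such terms.
Two reduced terms with the same lists are then compared.

Binary against binary (`equi_bin_bin`): if the first argument `s` of one is at most as long as the
first argument `s'` of the other, then the variables of `s` lie in `s'`. This forces both operations
to keep or reverse their arguments at the same `b`, and the four operations have different patterns
of signs, so they agree. Cutting out the piece of `s'` outside `s` turns the equality into an
instance of associativity.

Binary against `⊠` (`bin_ne_box`): a binary operation has only two possible orders, so it orders its
arguments in the same way at two of the three group elements, whereas `⊠` rotates its three blocks
between them. No cut into two nonempty pieces fits both rotations.

`⊠` against `⊠` (`equi_box_box`): comparing rotations shows that corresponding blocks have equal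
lengths, hence equal lists, and induction applies to each argument.

The image is `Q_G` because a group of order three has a single nontrivial orbit up to isomorphism,
so `ρ` is the only norm of arity three among the generators that come from the complete set of
orbits (`mem_QG_iff`). The primitive elements of `P_G(2)` are the four choices of values in `Σ₂` at
`g` and `g * g`, which are the four sign patterns (`isPrimitive_iff`). -/

/-! ### Permutations as lists -/

/-- The list of the inputs of an operation of `Assoc`, in the order prescribed by it. -/
def permList {n : ℕ} (σ : Perm (Fin n)) : List (Fin n) := (List.finRange n).map σ.symm

theorem permList_injective {n : ℕ} : Function.Injective (permList (n := n)) := by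
  intro σ τ h
  have h1 : (σ.symm : Fin n → Fin n) = τ.symm := by
    apply List.ofFn_injective
    simpa [permList, List.ofFn_eq_map] using h
  exact Equiv.symm_bijective.injective (DFunLike.coe_injective h1)

theorem permList_one (n : ℕ) : permList (1 : Perm (Fin n)) = List.finRange n :=
  List.map_id _

/-- The right action of `Σₙ` only relabels the entries of the list. This is why it turns into
renaming of variables on terms. -/
theorem permList_mul {n : ℕ} (σ τ : Perm (Fin n)) :
    permList (σ * τ) = (permList σ).map τ.symm := by
  simp only [permList, List.map_map]
  rfl

theorem permList_perm {n : ℕ} (σ : Perm (Fin n)) : (permList σ).Perm (List.finRange n) := by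
  refine (List.perm_ext_iff_of_nodup ((List.nodup_finRange n).map σ.symm.injective)
    (List.nodup_finRange n)).2 fun a => ?_
  simp only [List.mem_map, List.mem_finRange, true_and, iff_true]
  exact ⟨σ a, σ.symm_apply_apply a⟩

theorem permList_nodup {n : ℕ} (σ : Perm (Fin n)) : (permList σ).Nodup :=
  (List.nodup_finRange n).map σ.symm.injective

/-- Both lists are strictly increasing and have the same elements. -/
theorem finRange_sum {n : ℕ} (k : Fin n → ℕ) :
    List.finRange (∑ i, k i) =
      (List.finRange n).flatMap fun i => (List.finRange (k i)).map fun a =>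
        finSigmaFinEquiv ⟨i, a⟩ := by
  have hs : ((List.finRange n).flatMap fun i => (List.finRange (k i)).map fun a =>
      (finSigmaFinEquiv ⟨i, a⟩ : Fin (∑ i, k i))).Pairwise (· < ·) := by
    rw [List.pairwise_flatMap]
    refine ⟨fun i _ => ?_, ?_⟩
    · rw [List.pairwise_map]
      refine (List.pairwise_lt_finRange _).imp fun h => ?_
      rw [finSigma_lt]
      exact Or.inr ⟨rfl, h⟩
    · refine (List.pairwise_lt_finRange _).imp fun h => ?_
      simp only [List.mem_map, List.mem_finRange, true_and]
      rintro _ ⟨a, rfl⟩ _ ⟨b, rfl⟩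
      rw [finSigma_lt]
      exact Or.inl h
  refine List.Perm.eq_of_pairwise (le := (· < ·)) (fun a b _ _ h h' => absurd h' h.not_gt)
    (List.pairwise_lt_finRange _) hs ?_
  refine (List.perm_ext_iff_of_nodup (List.nodup_finRange _)
    (hs.imp fun h => ne_of_lt h)).2 fun x => ?_
  obtain ⟨i, a, rfl⟩ := exists_finSigma x
  simp

theorem permList_permutedBlockSum {n : ℕ} (σ : Perm (Fin n)) {k : Fin n → ℕ}
    (τ : ∀ i, Perm (Fin (k i))) :
    permList (permutedBlockSum σ τ) =
      (permList σ).flatMap fun i => (permList (τ i)).map fun a => finSigmaFinEquiv ⟨i, a⟩ := by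
  have h : List.finRange (∑ i, k i) =
      (List.finRange (∑ j, k (σ.symm j))).map (Fin.cast (sum_comp_symm σ k)) := by
    have : ∀ (m n : ℕ) (h : m = n), List.finRange n = (List.finRange m).map (Fin.cast h) := by
      rintro m n rfl
      exact (List.map_id _).symm
    exact this _ _ _
  rw [permList, h, finRange_sum]
  simp only [permList, List.map_flatMap, List.flatMap_map, List.map_map]
  refine List.flatMap_congr fun i _ => List.map_congr_left fun a _ => ?_
  exact permutedBlockSum_symm_apply σ τ i a

/-! ### Terms -/

/-- Terms with variables in `V` whose nodes with `n` inputs are labelled by elements of `L n`: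
planar trees with labelled leaves. -/
inductive OpTerm (L : ℕ → Type u) (V : Type w) : Type (max u w)
  | var (v : V) : OpTerm L V
  | node {n : ℕ} (a : L n) (t : Fin n → OpTerm L V) : OpTerm L V

namespace OpTerm

variable {L : ℕ → Type u} {V W U : Type*}

/-- Simultaneous substitution. -/
def bind : OpTerm L V → (V → OpTerm L W) → OpTerm L W
  | var v, s => s v
  | node a t, s => node a fun i => (t i).bind s

theorem var_bind (v : V) (s : V → OpTerm L W) : (var v).bind s = s v := rfl

/-- Renaming of variables. -/
def map (f : V → W) (t : OpTerm L V) : OpTerm L W := t.bind fun v => var (f v)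

/-- The term given by a planar tree and a labelling of its leaves. -/
def ofTree : (t : PlanarTree L) → (Fin t.leaves → V) → OpTerm L V
  | .leaf, l => var (l (0 : Fin 1))
  | .node a t, l => node a fun i => ofTree (t i) fun j => l (finSigmaFinEquiv ⟨i, j⟩)

/-- The planar tree underlying a term. -/
def toTree : OpTerm L V → PlanarTree L
  | var _ => .leaf
  | node a t => .node a fun i => (t i).toTree

theorem bind_bind (s : V → OpTerm L W) (r : W → OpTerm L U) : ∀ t : OpTerm L V,
    (t.bind s).bind r = t.bind fun v => (s v).bind r
  | var _ => rfl
  | node a t => congrArg (node a) (funext fun i => bind_bind s r (t i))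

theorem bind_map (s : V → OpTerm L W) (f : W → U) (t : OpTerm L V) :
    (t.bind s).map f = t.bind fun v => (s v).map f :=
  bind_bind _ _ t

theorem map_map (f : V → W) (g : W → U) (t : OpTerm L V) :
    (t.map f).map g = t.map fun v => g (f v) :=
  bind_bind _ _ t

theorem bind_var : ∀ t : OpTerm L V, t.bind var = t
  | var _ => rfl
  | node a t => congrArg (node a) (funext fun i => bind_var (t i))

theorem map_id (t : OpTerm L V) : t.map (fun v => v) = t :=
  bind_var t

theorem map_ofTree (f : V → W) : ∀ (t : PlanarTree L) (l : Fin t.leaves → V),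
    (ofTree t l).map f = ofTree t fun j => f (l j)
  | .leaf, _ => rfl
  | .node a t, _ => congrArg (node a) (funext fun i => map_ofTree f (t i) _)

theorem toTree_ofTree : ∀ (t : PlanarTree L) (l : Fin t.leaves → V), (ofTree t l).toTree = t
  | .leaf, _ => rfl
  | .node a t, _ => congrArg (PlanarTree.node a) (funext fun i => toTree_ofTree (t i) _)

theorem exists_ofTree : ∀ t : OpTerm L V, ∃ l, t = ofTree t.toTree l
  | var v => ⟨fun _ => v, rfl⟩
  | node a t => by
    choose l hl using fun i => exists_ofTree (t i)
    refine ⟨fun x => l (finSigmaFinEquiv.symm x).1 (finSigmaFinEquiv.symm x).2, ?_⟩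
    refine congrArg (node a) (funext fun i => (hl i).trans (congrArg _ (funext fun j => ?_)))
    have := finSigmaFinEquiv.symm_apply_apply (⟨i, j⟩ : Σ i, Fin (t i).toTree.leaves)
    exact (congrArg (fun x : Σ i, Fin (t i).toTree.leaves => l x.1 x.2) this).symm

theorem ofTree_injective : ∀ (t : PlanarTree L) (l l' : Fin t.leaves → V),
    ofTree t l = ofTree t l' → l = l'
  | .leaf, l, l', h => by
    funext (j : Fin 1)
    rw [Subsingleton.elim j 0]
    exact OpTerm.var.inj h
  | .node a t, l, l', h => by
    have h1 := eq_of_heq (OpTerm.node.inj h).2.2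
    funext x
    obtain ⟨i, j, rfl⟩ := exists_finSigma (k := fun i => (t i).leaves) x
    exact congrFun (ofTree_injective (t i) _ _ (congrFun h1 i)) j

/-- The labels `l₀` and the substitution `r` are arbitrary so that the induction hypothesis applies
to a subtree, whose leaves keep their labels from the whole tree. -/
theorem ofTree_graft : ∀ (t : PlanarTree L) (s : Fin t.leaves → PlanarTree L)
    (l : Fin (t.graft s).leaves → V) (l₀ : Fin t.leaves → W) (r : W → OpTerm L V),
    (∀ j, r (l₀ j) = ofTree (s j) fun a =>
      l (Fin.cast (PlanarTree.leaves_graft t s).symm (finSigmaFinEquiv ⟨j, a⟩))) →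
    ofTree (t.graft s) l = (ofTree t l₀).bind r
  | .leaf, s, l, l₀, r, h => by
    refine Eq.trans ?_ (h (0 : Fin 1)).symm
    show ofTree (s (0 : Fin 1)) l = _
    refine congrArg _ (funext fun j => congrArg l (Fin.ext ?_))
    refine Eq.symm ((finSigma_val (n := 1) (k := fun i => (s i).leaves) 0 j).trans ?_)
    simp
  | .node a t, s, l, l₀, r, h => by
    refine congrArg (node a) (funext fun i => ?_)
    refine ofTree_graft (t i) _ _ _ r fun j => (h _).trans ?_
    refine congrArg _ (funext fun b => congrArg l (Fin.ext ?_))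
    refine Eq.trans
      (finSigma_assoc (k := fun i => (t i).leaves) (l := fun x => (s x).leaves) i j b).symm ?_
    have := PlanarTree.finSigma_cast_snd
      (k := fun i => ((t i).graft fun j => s (finSigmaFinEquiv ⟨i, j⟩)).leaves)
      (fun i => PlanarTree.leaves_graft (t i) fun j => s (finSigmaFinEquiv ⟨i, j⟩))
      (Finset.sum_congr rfl fun i _ => PlanarTree.leaves_graft (t i) _) i
      (Fin.cast (PlanarTree.leaves_graft (t i) _).symm (finSigmaFinEquiv ⟨j, b⟩))
    exact (congrArg Fin.val this).symm

end OpTerm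

/-! ### Operations of the free operad as terms. -/

namespace freeOperad

variable {G : Type v} [Group G] {S : ℕ → Type u}

/-- The term that corresponds to an operation of the free operad: its leaves are labelled by the
inputs of the operation. -/
def toTerm {n : ℕ} (x : (freeOperad G S).obj n) : OpTerm (fun k => G × S k) (Fin n) :=
  OpTerm.ofTree x.1.1 fun j => x.2.symm (Fin.cast x.1.2 j)

theorem toTerm_act {n : ℕ} (x : (freeOperad G S).obj n) (σ : Perm (Fin n)) :
    toTerm ((freeOperad G S).act x σ) = (toTerm x).map σ.symm :=
  (OpTerm.map_ofTree σ.symm x.1.1 fun j => x.2.symm (Fin.cast x.1.2 j)).symm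

theorem toTerm_castArity {m n : ℕ} (h : m = n) (x : (freeOperad G S).obj m) :
    toTerm (castArity (freeOperad G S).obj h x) = (toTerm x).map (Fin.cast h) := by
  subst h
  exact (OpTerm.map_id _).symm

theorem toTerm_unit : toTerm (freeOperad G S).unit = OpTerm.var 0 := rfl

theorem toTerm_comp {n : ℕ} (x : (freeOperad G S).obj n) {k : Fin n → ℕ}
    (h : ∀ i, (freeOperad G S).obj (k i)) :
    toTerm ((freeOperad G S).comp x h) =
      (toTerm x).bind fun i => (toTerm (h i)).map fun a => finSigmaFinEquiv ⟨i, a⟩ := by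
  obtain ⟨⟨t, rfl⟩, σ⟩ := x
  refine OpTerm.ofTree_graft _ _ _ _ _ fun j => (OpTerm.map_ofTree _ _ _).trans ?_
  refine congrArg _ (funext fun a => ?_)
  have h1 := permutedBlockSum_symm_apply σ (fun i => (h i).2) j
    (Fin.cast (h (σ.symm j)).1.2 a)
  refine Eq.trans h1.symm (congrArg _ (Fin.ext ?_))
  have h2 := congrArg Fin.val (PlanarTree.finSigma_cast_snd
    (fun i => (h (σ.symm i)).1.2) (Finset.sum_congr rfl fun i _ => (h (σ.symm i)).1.2) j a)
  exact h2.symm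

theorem toTerm_smul_gen (a : G) {n : ℕ} (s : S n) :
    toTerm ((freeOperad G S).smul a (gen s)) = OpTerm.node (a, s) OpTerm.var := by
  show OpTerm.node (L := fun k => G × S k) (a * 1, s) _ = _
  rw [mul_one]
  refine congrArg _ (funext fun i => congrArg OpTerm.var (Fin.ext ?_))
  refine (finSigma_val (k := fun _ : Fin n => 1) i (0 : Fin 1)).trans ?_
  rw [sum_lt_one]
  rfl

theorem toTerm_gen {n : ℕ} (s : S n) :
    toTerm (gen (G := G) s) = OpTerm.node (1, s) OpTerm.var := by
  rw [← toTerm_smul_gen, (freeOperad G S).one_smul]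

/-- Number the leaves from left to right and recover the variables by `l`. Repeated variables are
allowed, since `l` need not be injective. -/
theorem exists_toTerm_map {V : Type*} (t : OpTerm (fun k => G × S k) V) :
    ∃ (n : ℕ) (x : (freeOperad G S).obj n) (l : Fin n → V), t = (toTerm x).map l := by
  obtain ⟨l, hl⟩ := t.exists_ofTree
  exact ⟨_, (⟨t.toTree, rfl⟩, 1), l, hl.trans (OpTerm.map_ofTree _ _ _).symm⟩

/-- A term determines its tree and the labels of its leaves, so `x` and `y` share a tree and differ
only in the numbering of the leaves. -/
theorem exists_act_of_map_eq {V : Type*} {m n : ℕ} {x : (freeOperad G S).obj m}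
    {y : (freeOperad G S).obj n} {l : Fin m → V} {l' : Fin n → V}
    (h : (toTerm x).map l = (toTerm y).map l') :
    ∃ (e : n = m) (σ : Perm (Fin m)),
      castArity (freeOperad G S).obj e y = (freeOperad G S).act x σ ∧
        ∀ i, l i = l' (Fin.cast e.symm (σ.symm i)) := by
  obtain ⟨⟨t, rfl⟩, σ⟩ := x
  obtain ⟨⟨t', rfl⟩, σ'⟩ := y
  simp only [toTerm, OpTerm.map_ofTree] at h
  have h1 := congrArg OpTerm.toTree h
  simp only [OpTerm.toTree_ofTree] at h1
  subst h1
  have h2 := OpTerm.ofTree_injective _ _ _ h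
  -- On a common tree, `σ⁻¹ * σ'` carries the numbering `σ` to `σ'`.
  refine ⟨rfl, σ⁻¹ * σ', Prod.ext rfl (by simp [castArity, freeOperad]), fun i => ?_⟩
  refine Eq.trans (congrArg l (σ.symm_apply_apply i).symm) (congrFun h2 (σ i))

end freeOperad

/-! ### The map from a free operad to `P_G` given by permutation representations -/

namespace OpTerm

variable {G : Type v} [Group G] {S : ℕ → Type u} (ν : ∀ n, S n → G →* Perm (Fin n))
  {V W : Type*}

/-- The labels of the leaves of a term, in the linear order that belongs to the element `b` of the
group, when every symbol acts through the permutation representation given by `ν`. -/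
def ord (b : G) : OpTerm (fun k => G × S k) V → List V
  | var v => [v]
  | @node _ _ n a t => (permList (ν n a.2 (b * a.1))).flatMap fun i => (t i).ord b

theorem ord_bind (b : G) (s : V → OpTerm (fun k => G × S k) W) :
    ∀ t : OpTerm (fun k => G × S k) V,
      (t.bind s).ord ν b = (t.ord ν b).flatMap fun v => (s v).ord ν b
  | var v => by simp [bind, ord]
  | node a t => by simp only [bind, ord, List.flatMap_assoc, ord_bind b s]

theorem ord_map (b : G) (f : V → W) (t : OpTerm (fun k => G × S k) V) :
    (t.map f).ord ν b = (t.ord ν b).map f := by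
  rw [map, ord_bind, ← List.flatMap_pure_eq_map]
  rfl

/-- The group element affects only the order of the variables. Lengths, emptiness and absence of
repetitions can therefore be tested at `1`. -/
theorem ord_perm (b c : G) : ∀ t : OpTerm (fun k => G × S k) V,
    (t.ord ν b).Perm (t.ord ν c)
  | var _ => .refl _
  | node _ t => List.Perm.flatMap ((permList_perm _).trans (permList_perm _).symm)
      fun i _ => ord_perm b c (t i)

/-- The permutation of the leaves of a tree that belongs to the element `b` of the group. -/
def treePerm (b : G) : (t : PlanarTree fun k => G × S k) → Perm (Fin t.leaves)
  | .leaf => (1 : Perm (Fin 1))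
  | @PlanarTree.node _ n a t => permutedBlockSum (ν n a.2 (b * a.1)) fun i => treePerm b (t i)

theorem ord_ofTree (b : G) : ∀ (t : PlanarTree fun k => G × S k) (l : Fin t.leaves → V),
    (ofTree t l).ord ν b = (permList (treePerm ν b t)).map l
  | .leaf, _ => rfl
  | .node a t, l => by
    simp only [ofTree, ord, treePerm, ord_ofTree b (t _)]
    refine Eq.trans ?_ (congrArg (List.map l) (permList_permutedBlockSum _ _).symm)
    refine Eq.trans ?_ List.map_flatMap.symm
    exact List.flatMap_congr fun i _ => List.map_map.symm

/-- A node label `c` enters only through the product `b * c`, so multiplying all labels by `a` on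
the left replaces `b` by `b * a`. -/
theorem ord_ofTree_map (a b : G) : ∀ (t : PlanarTree fun k => G × S k)
    (l : Fin (t.map fun c => (a * c.1, c.2)).leaves → V),
    (ofTree (t.map fun c => (a * c.1, c.2)) l).ord ν b =
      (ofTree t fun j => l (Fin.cast (PlanarTree.leaves_map _ t).symm j)).ord ν (b * a)
  | .leaf, _ => rfl
  | .node c t, l => by
    simp only [PlanarTree.map, ofTree, ord, mul_assoc]
    refine List.flatMap_congr fun i _ => (ord_ofTree_map a b (t i) _).trans ?_
    congr 2
    funext j
    refine congrArg l (Fin.ext ?_)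
    have := PlanarTree.finSigma_cast_snd (fun i => (PlanarTree.leaves_map
      (fun {n} (c : G × S n) => (a * c.1, c.2)) (t i)).symm)
      (Finset.sum_congr rfl fun i _ => (PlanarTree.leaves_map
      (fun {n} (c : G × S n) => (a * c.1, c.2)) (t i)).symm) i j
    exact (congrArg Fin.val this).symm

end OpTerm

namespace freeOperad

variable {G : Type v} [Group G] {S : ℕ → Type u} (ν : ∀ n, S n → G →* Perm (Fin n))

/-- The family of permutations of the inputs given by an operation of the free operad. -/
def eval {n : ℕ} (x : (freeOperad G S).obj n) : G → Perm (Fin n) := fun b =>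
  castArity (fun n => Perm (Fin n)) x.1.2 (OpTerm.treePerm ν b x.1.1) * x.2

theorem permList_eval {n : ℕ} (x : (freeOperad G S).obj n) (b : G) :
    permList (eval ν x b) = (toTerm x).ord ν b := by
  obtain ⟨⟨t, rfl⟩, σ⟩ := x
  exact (permList_mul _ σ).trans (OpTerm.ord_ofTree ν b t _).symm

theorem eval_eq_iff {n : ℕ} (x y : (freeOperad G S).obj n) :
    eval ν x = eval ν y ↔ ∀ b, (toTerm x).ord ν b = (toTerm y).ord ν b := by
  simp only [← permList_eval, permList_injective.eq_iff, funext_iff]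

theorem nodup_ord_toTerm {n : ℕ} (x : (freeOperad G S).obj n) (b : G) :
    ((toTerm x).ord ν b).Nodup := by
  rw [← permList_eval]
  exact permList_nodup _

theorem eval_smul {n : ℕ} (a : G) (x : (freeOperad G S).obj n) (b : G) :
    eval ν ((freeOperad G S).smul a x) b = eval ν x (b * a) := by
  obtain ⟨⟨t, rfl⟩, σ⟩ := x
  apply permList_injective
  refine (permList_eval ν _ b).trans (Eq.trans ?_ (permList_eval ν _ (b * a)).symm)
  exact OpTerm.ord_ofTree_map ν a b t _

theorem eval_gen {n : ℕ} (s : S n) : eval ν (gen (G := G) s) = PG.norm (ν n s) := by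
  funext b
  apply permList_injective
  rw [permList_eval, toTerm_gen, OpTerm.ord, mul_one]
  exact (List.flatMap_pure_eq_map _ _).trans (List.map_id _)

/-- The map of operads from the free operad to `P_G` that sends every symbol `s` to the norm of
the permutation representation `ν s`. -/
def toPG : GOperad.Hom (freeOperad G S) (PG G) where
  toFun x := eval ν x
  map_act x σ := by
    funext b
    apply permList_injective
    refine (permList_eval ν _ b).trans ?_
    rw [toTerm_act, OpTerm.ord_map, ← permList_eval]
    exact (permList_mul _ _).symm
  map_smul a x := funext fun b => eval_smul ν a x b
  map_unit := by
    funext b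
    apply permList_injective
    refine (permList_eval ν _ b).trans ?_
    exact (permList_one 1).symm
  map_comp x k h := by
    funext b
    apply permList_injective
    refine (permList_eval ν _ b).trans ?_
    rw [toTerm_comp, OpTerm.ord_bind]
    refine Eq.trans ?_ (permList_permutedBlockSum (eval ν x b) fun i => eval ν (h i) b).symm
    simp only [OpTerm.ord_map, permList_eval]

theorem eval_mem {N : GOperad.Suboperad (PG G)}
    (hN : ∀ (n : ℕ) (s : S n), PG.norm (ν n s) ∈ N.carrier n) {n : ℕ}
    (x : (freeOperad G S).obj n) : (toPG ν).toFun x ∈ N.carrier n := by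
  have h : ∀ t : PlanarTree fun k => G × S k,
      (show (PG G).obj t.leaves from fun b => OpTerm.treePerm ν b t) ∈ N.carrier t.leaves := by
    intro t
    induction t with
    | leaf => exact N.unit_mem
    -- The group part of the node label acts on the norm by shifting `b` to `b * a.1`, as in
    -- `treePerm`.
    | node a t ih => exact N.comp_mem (N.smul_mem a.1 (hN _ a.2)) ih
  obtain ⟨⟨t, rfl⟩, σ⟩ := x
  exact N.act_mem σ (h t)

/-- The image of the map to `P_G`, as a suboperad. -/
def range : GOperad.Suboperad (PG G) where
  carrier n := Set.range fun x : (freeOperad G S).obj n => (toPG ν).toFun x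
  act_mem := by
    rintro n _ σ ⟨x, rfl⟩
    exact ⟨_, (toPG ν).map_act x σ⟩
  smul_mem := by
    rintro n a _ ⟨x, rfl⟩
    exact ⟨_, (toPG ν).map_smul a x⟩
  unit_mem := ⟨_, (toPG ν).map_unit⟩
  comp_mem := by
    rintro n _ k h ⟨x, rfl⟩ hh
    choose y hy using hh
    obtain rfl : (fun i => (toPG ν).toFun (y i)) = h := funext hy
    exact ⟨_, (toPG ν).map_comp x y⟩

end freeOperad

/-! ### The equational theory of the presentation -/

/-- The permutation representations of the symbols: `⊠` acts through `ρ`, the other symbols act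
trivially. -/
def C3Gen.rep {G : Type v} [Group G] (ρ : G →* Perm (Fin 3)) : ∀ n, C3Gen n → G →* Perm (Fin n)
  | _, .e => 1
  | _, .tensor => 1
  | _, .box => ρ

/-- Terms in the symbols `e`, `⊗` and `⊠`. -/
abbrev C3Term (G : Type v) (V : Type w) : Type (max v w) := OpTerm (fun k => G × C3Gen k) V

/-- The cyclic permutation `(1 2 3)`. -/
abbrev cycle₃ : Perm (Fin 3) := c[(0 : Fin 3), 1, 2]

/-- Names for the four primitive binary operations. -/
inductive C3Bin
  | tensor
  | box₁
  | box₂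
  | box₃

/-- Whether a binary operation keeps the order of its inputs in the linear order that belongs to
an element of the group that acts by `σ` on the inputs of `⊠`. -/
def C3Bin.sgn : C3Bin → Perm (Fin 3) → Bool
  | .tensor, _ => true
  | .box₁, σ => σ 1 < σ 2
  | .box₂, σ => σ 0 < σ 2
  | .box₃, σ => σ 0 < σ 1

theorem C3Bin.sgn_one (d : C3Bin) : d.sgn 1 = true := by
  cases d <;> decide

theorem C3Bin.sgn_cycle (d : C3Bin) : d.sgn cycle₃ =
    match d with | .tensor => true | .box₁ => false | .box₂ => false | .box₃ => true := by
  cases d <;> decide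

theorem C3Bin.sgn_cycle_sq (d : C3Bin) : d.sgn (cycle₃ * cycle₃) =
    match d with | .tensor => true | .box₁ => true | .box₂ => false | .box₃ => false := by
  cases d <;> decide

/-- The signs at the cycle and at its square are `(+,+)`, `(-,+)`, `(-,-)`, `(+,-)` for `tensor`,
`box₁`, `box₂`, `box₃`. -/
theorem C3Bin.ext_sgn {d d' : C3Bin} (h : d.sgn cycle₃ = d'.sgn cycle₃)
    (h' : d.sgn (cycle₃ * cycle₃) = d'.sgn (cycle₃ * cycle₃)) : d = d' := by
  rw [sgn_cycle, sgn_cycle] at h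
  rw [sgn_cycle_sq, sgn_cycle_sq] at h'
  cases d <;> cases d' <;>
    first | rfl | exact absurd h Bool.noConfusion | exact absurd h' Bool.noConfusion

/-! ### The equational theory and its soundness. -/

namespace C3Term

open OpTerm

variable {G : Type v} [Group G] {V : Type w}

/-- The constant `e`. -/
def e : C3Term G V := node (1, C3Gen.e) ![]

/-- The operation `⊗` on terms. -/
def tensor (s t : C3Term G V) : C3Term G V := node (1, C3Gen.tensor) ![s, t]

/-- The operation `⊠` on terms. -/
def box (s t r : C3Term G V) : C3Term G V := node (1, C3Gen.box) ![s, t, r]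

/-- The four primitive binary operations on terms. -/
def bin : C3Bin → C3Term G V → C3Term G V → C3Term G V
  | .tensor, s, t => tensor s t
  | .box₁, s, t => box e s t
  | .box₂, s, t => box s e t
  | .box₃, s, t => box s t e

/-- The equational theory that corresponds to the presentation. -/
inductive Equi (ρ : G →* Perm (Fin 3)) : C3Term G V → C3Term G V → Prop
  | refl (t : C3Term G V) : Equi ρ t t
  | symm {s t : C3Term G V} : Equi ρ s t → Equi ρ t s
  | trans {s t r : C3Term G V} : Equi ρ s t → Equi ρ t r → Equi ρ s r
  | node {n : ℕ} (a : G × C3Gen n) (s t : Fin n → C3Term G V) :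
      (∀ i, Equi ρ (s i) (t i)) → Equi ρ (node a s) (node a t)
  | smul {n : ℕ} (a : G) (x : C3Gen n) (t : Fin n → C3Term G V) :
      Equi ρ (OpTerm.node (a, x) t) (OpTerm.node (1, x) fun i => t ((C3Gen.rep ρ n x a).symm i))
  | bin_e (d : C3Bin) (t : C3Term G V) : Equi ρ (bin d t e) t
  | e_bin (d : C3Bin) (t : C3Term G V) : Equi ρ (bin d e t) t
  | assoc (d : C3Bin) (s t r : C3Term G V) :
      Equi ρ (bin d (bin d s t) r) (bin d s (bin d t r))

theorem Equi.box {ρ : G →* Perm (Fin 3)} {s s' t t' r r' : C3Term G V} (h : Equi ρ s s')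
    (h' : Equi ρ t t') (h'' : Equi ρ r r') : Equi ρ (box s t r) (box s' t' r') := by
  refine .node _ _ _ fun i => ?_
  fin_cases i
  exacts [h, h', h'']

theorem Equi.bin {ρ : G →* Perm (Fin 3)} (d : C3Bin) {s s' t t' : C3Term G V} (h : Equi ρ s s')
    (h' : Equi ρ t t') : Equi ρ (bin d s t) (bin d s' t') := by
  cases d
  · refine .node _ _ _ fun i => ?_
    fin_cases i
    exacts [h, h']
  exacts [.box (.refl _) h h', .box h (.refl _) h', .box h h' (.refl _)]

/-- The linear order of the variables of a term that belongs to an element of the group. -/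
abbrev ord (ρ : G →* Perm (Fin 3)) (b : G) (t : C3Term G V) : List V :=
  OpTerm.ord (C3Gen.rep ρ) b t

/-- The group acts on the inputs of `⊠` by cyclic permutations. -/
def IsCyclic (ρ : G →* Perm (Fin 3)) : Prop :=
  ∀ b, ρ b = 1 ∨ ρ b = cycle₃ ∨ ρ b = cycle₃ * cycle₃

variable (ρ : G →* Perm (Fin 3))

theorem ord_e (b : G) : ord ρ b (e : C3Term G V) = [] := rfl

theorem ord_tensor (b : G) (s t : C3Term G V) :
    ord ρ b (tensor s t) = ord ρ b s ++ ord ρ b t := by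
  show (permList (1 : Perm (Fin 2))).flatMap _ = _
  rw [permList_one, show List.finRange 2 = [0, 1] from rfl]
  simp

theorem ord_box (b : G) (s t r : C3Term G V) :
    ord ρ b (box s t r) =
      (permList (ρ b)).flatMap fun i => ord ρ b (![s, t, r] i) := by
  show (permList (ρ (b * 1))).flatMap _ = _
  rw [mul_one]

variable {ρ}

theorem ord_box_of_eq_one {b : G} (h : ρ b = 1) (s t r : C3Term G V) :
    ord ρ b (box s t r) = ord ρ b s ++ ord ρ b t ++ ord ρ b r := by
  rw [ord_box, h, show permList (1 : Perm (Fin 3)) = [0, 1, 2] by decide]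
  simp

theorem ord_box_of_eq_cycle {b : G} (h : ρ b = cycle₃) (s t r : C3Term G V) :
    ord ρ b (box s t r) = ord ρ b r ++ ord ρ b s ++ ord ρ b t := by
  rw [ord_box, h, show permList (cycle₃) = [2, 0, 1] by decide]
  simp

theorem ord_box_of_eq_cycle_sq {b : G} (h : ρ b = cycle₃ * cycle₃)
    (s t r : C3Term G V) : ord ρ b (box s t r) = ord ρ b t ++ ord ρ b r ++ ord ρ b s := by
  rw [ord_box, h, show permList (cycle₃ * cycle₃) = [1, 2, 0] by decide]
  simp

/-- The constant `e` contributes the empty list, so a rotated triple with one entry `e` leaves the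
other two either in order or exchanged. -/
theorem ord_bin (hρ : IsCyclic ρ) (b : G) (d : C3Bin) (s t : C3Term G V) :
    ord ρ b (bin d s t) =
      if d.sgn (ρ b) then ord ρ b s ++ ord ρ b t else ord ρ b t ++ ord ρ b s := by
  cases d
  · simp [bin, ord_tensor, C3Bin.sgn]
  all_goals
    rcases hρ b with h | h | h
    · simp [bin, ord_box_of_eq_one h, ord_e, h, C3Bin.sgn_one]
    · rw [h, C3Bin.sgn_cycle]
      simp [bin, ord_box_of_eq_cycle h, ord_e]
    · rw [h, C3Bin.sgn_cycle_sq]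
      simp [bin, ord_box_of_eq_cycle_sq h, ord_e]

/-- Soundness. Associativity holds because the sign depends only on `d` and `b`: at each `b` the
operation is concatenation or reversed concatenation. The rule `smul` holds because the
representations are multiplicative. -/
theorem Equi.ord_eq (hρ : IsCyclic ρ) {s t : C3Term G V} (h : Equi ρ s t) (b : G) :
    ord ρ b s = ord ρ b t := by
  induction h with
  | refl => rfl
  | symm _ ih => exact ih.symm
  | trans _ _ ih ih' => exact ih.trans ih'
  | node a s t _ ih => simp only [ord, OpTerm.ord, ih]
  | smul a x t =>
    simp only [ord, OpTerm.ord, map_mul, permList_mul, List.flatMap_map, map_one]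
    rfl
  | bin_e d t => simp [ord_bin hρ, ord_e]
  | e_bin d t => simp [ord_bin hρ, ord_e]
  | assoc d s t r =>
    simp only [ord_bin hρ]
    split_ifs <;> simp

/-! ### Reduction of terms -/

/-- A term is reduced if `e` does not occur as an input of its outermost operation. -/
inductive Reduced (ρ : G →* Perm (Fin 3)) : C3Term G V → Prop
  | e : Reduced ρ e
  | var (v : V) : Reduced ρ (var v)
  | bin (d : C3Bin) {s t : C3Term G V} (hs : ord ρ 1 s ≠ []) (ht : ord ρ 1 t ≠ []) :
      Reduced ρ (bin d s t)
  | box {s t r : C3Term G V} (hs : ord ρ 1 s ≠ []) (ht : ord ρ 1 t ≠ []) (hr : ord ρ 1 r ≠ []) :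
      Reduced ρ (box s t r)

theorem Reduced.eq_e (hρ : IsCyclic ρ) {t : C3Term G V} (h : Reduced ρ t) (h' : ord ρ 1 t = []) :
    t = C3Term.e := by
  cases h with
  | e => rfl
  | var v => simp [ord, OpTerm.ord] at h'
  | bin d hs ht =>
    rw [ord_bin hρ, map_one, C3Bin.sgn_one] at h'
    simp_all
  | box hs ht hr =>
    rw [ord_box_of_eq_one (map_one ρ)] at h'
    simp_all

/-- The terms that are equivalent to a reduced term. -/
def Reducible (ρ : G →* Perm (Fin 3)) (t : C3Term G V) : Prop := ∃ t', Equi ρ t t' ∧ Reduced ρ t'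

theorem Reducible.of_equi {s t : C3Term G V} (h : Equi ρ s t) (ht : Reducible ρ t) :
    Reducible ρ s :=
  ht.imp fun _ h' => ⟨h.trans h'.1, h'.2⟩

theorem Reducible.equi_e (hρ : IsCyclic ρ) {t : C3Term G V} (h : Reducible ρ t)
    (h' : ord ρ 1 t = []) : Equi ρ t e := by
  obtain ⟨t', h1, h2⟩ := h
  rw [h1.ord_eq hρ] at h'
  rwa [h2.eq_e hρ h'] at h1

theorem Reducible.bin (hρ : IsCyclic ρ) (d : C3Bin) {s t : C3Term G V} (hs : Reducible ρ s)
    (ht : Reducible ρ t) : Reducible ρ (bin d s t) := by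
  by_cases h : ord ρ 1 s = []
  · exact .of_equi ((Equi.bin d (hs.equi_e hρ h) (.refl _)).trans (.e_bin d t)) ht
  by_cases h' : ord ρ 1 t = []
  · exact .of_equi ((Equi.bin d (.refl _) (ht.equi_e hρ h')).trans (.bin_e d s)) hs
  exact ⟨_, .refl _, .bin d h h'⟩

/-- An argument without variables is equivalent to `e`, which turns `⊠` into one of the binary
operations. -/
theorem Reducible.box (hρ : IsCyclic ρ) {s t r : C3Term G V} (hs : Reducible ρ s)
    (ht : Reducible ρ t) (hr : Reducible ρ r) : Reducible ρ (box s t r) := by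
  by_cases h : ord ρ 1 s = []
  · exact .of_equi (.box (hs.equi_e hρ h) (.refl _) (.refl _)) (ht.bin hρ .box₁ hr)
  by_cases h' : ord ρ 1 t = []
  · exact .of_equi (.box (.refl _) (ht.equi_e hρ h') (.refl _)) (hs.bin hρ .box₂ hr)
  by_cases h'' : ord ρ 1 r = []
  · exact .of_equi (.box (.refl _) (.refl _) (hr.equi_e hρ h'')) (hs.bin hρ .box₃ ht)
  exact ⟨_, .refl _, .box h h' h''⟩

theorem reducible (hρ : IsCyclic ρ) (t : C3Term G V) : Reducible ρ t := by
  induction t with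
  | var v => exact ⟨_, .refl _, .var v⟩
  | @node n a t ih =>
    obtain ⟨a, x⟩ := a
    -- The rule `smul` trades the group label of the root for a permutation of its children.
    refine .of_equi (.smul a x t) ?_
    cases x with
    | e => exact ⟨_, .refl _, by
      convert Reduced.e
      exact congrArg (OpTerm.node _) (Subsingleton.elim _ _)⟩
    | tensor =>
      convert Reducible.bin hρ .tensor (ih 0) (ih 1) using 1
      refine congrArg (OpTerm.node _) (funext fun i => ?_)
      fin_cases i <;> rfl
    | box =>
      convert Reducible.box hρ (ih ((ρ a).symm 0)) (ih ((ρ a).symm 1)) (ih ((ρ a).symm 2)) using 1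
      refine congrArg (OpTerm.node _) (funext fun i => ?_)
      fin_cases i <;> rfl

end C3Term

/-! ### Concatenations of lists without repetitions -/

namespace List

variable {α : Type*}

theorem exists_mem_of_append_eq_append {A B C D : List α} (h : A ++ B = C ++ D) (hA : A ≠ [])
    (hC : C ≠ []) : ∃ x ∈ A, x ∈ C := by
  cases A with
  | nil => exact absurd rfl hA
  | cons a A =>
    cases C with
    | nil => exact absurd rfl hC
    | cons c C =>
      obtain rfl : a = c := by simpa using congrArg List.head? h
      exact ⟨a, mem_cons_self, mem_cons_self⟩

/-- Both `A` and `C` are initial segments of one word. As `A` reaches into `D`, it contains all of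
`C`. -/
theorem subset_of_append_eq_append {A B C D : List α} (h : A ++ B = C ++ D)
    (hn : (A ++ B).Nodup) {x : α} (hA : x ∈ A) (hD : x ∈ D) : C ⊆ A := by
  rcases append_eq_append_iff.1 h with ⟨r, rfl, rfl⟩ | ⟨r, rfl, rfl⟩
  · exact absurd (mem_append_right r hD) ((nodup_append.1 hn).2.2 x hA x · rfl)
  · exact subset_append_left _ _

theorem subset_of_append_eq_append' {A B C D : List α} (h : A ++ B = C ++ D)
    (hn : (A ++ B).Nodup) {x : α} (hB : x ∈ B) (hC : x ∈ C) : D ⊆ B := by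
  have h' : B.reverse ++ A.reverse = D.reverse ++ C.reverse := by
    simpa using congrArg List.reverse h
  have := subset_of_append_eq_append h' (by simpa using List.nodup_reverse.2 hn) (x := x)
    (by simpa using hB) (by simpa using hC)
  simpa using this

/-- A word cannot be divided into two parts compatibly with a division into three parts that are
rotated. -/
theorem append_ne_of_rotate {A B X Y Z A' B' X' Y' Z' : List α} (hn : (A ++ B).Nodup)
    (h : A ++ B = X ++ Y ++ Z) (h' : A' ++ B' = Y' ++ Z' ++ X') (hA : A.Perm A') (hB : B.Perm B')
    (hX : X.Perm X') (hY : Y.Perm Y') (hZ : Z.Perm Z') (hA0 : A ≠ []) (hB0 : B ≠ [])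
    (hX0 : X ≠ []) (hY0 : Y ≠ []) : False := by
  have hn' : (A' ++ B').Nodup := (hA.append hB).nodup_iff.1 hn
  have hA0' : A' ≠ [] := fun h => hA0 (perm_nil.1 (h ▸ hA))
  have hY0' : Y' ≠ [] := fun h => hY0 (perm_nil.1 (h ▸ hY))
  rw [append_assoc] at h h'
  -- The first letter of the second word is common to `A` and `Y`. In the first word `Y` comes after
  -- `X`, so `X` lies in `A`. In the second word `X'` comes last, so `Y'` and `Z'` lie in `A'` as
  -- well, and nothing is left for `B`.
  obtain ⟨y, hyA, hyY⟩ := exists_mem_of_append_eq_append h' hA0' hY0'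
  have h1 : X ⊆ A := subset_of_append_eq_append h hn (hA.mem_iff.2 hyA)
    (mem_append_left _ (hY.mem_iff.2 hyY))
  obtain ⟨x, hx⟩ := exists_mem_of_ne_nil X hX0
  rw [← append_assoc] at h'
  have h2 : Y' ++ Z' ⊆ A' := subset_of_append_eq_append h' hn' (hA.mem_iff.1 (h1 hx))
    (hX.mem_iff.1 hx)
  obtain ⟨b, hb⟩ := exists_mem_of_ne_nil B hB0
  have h3 : b ∈ A := by
    have : b ∈ X ++ (Y ++ Z) := h ▸ mem_append_right A hb
    rcases mem_append.1 this with hb | hb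
    · exact h1 hb
    · exact hA.mem_iff.2 (h2 (((hY.append hZ).mem_iff).1 hb))
  exact (nodup_append.1 hn).2.2 b h3 b hb rfl

/-- The blocks `A` and `X` come first in one word and last in the other. If `A` were longer than
`X`, it would reach into `Y` in the first word and into `Z` in the second. Meeting `Z`, it contains
`X` and `Y` by the first word; meeting `Y`, it contains `Z` by the second. Then `B` would be empty.
-/
theorem length_le_of_rotate {A B C X Y Z A' B' C' X' Y' Z' : List α}
    (hn : (A ++ B ++ C).Nodup) (h : A ++ B ++ C = X ++ Y ++ Z)
    (h' : B' ++ C' ++ A' = Y' ++ Z' ++ X') (hA : A.Perm A') (hB : B.Perm B') (hC : C.Perm C')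
    (hX : X.Perm X') (hY : Y.Perm Y') (hZ : Z.Perm Z') (hB0 : B ≠ []) (hY0 : Y ≠ [])
    (hZ0 : Z ≠ []) : A.length ≤ X.length := by
  by_contra! hlt
  have hn' : (B' ++ C' ++ A').Nodup :=
    (perm_append_comm.trans (((hB.append hC).append hA))).nodup_iff.1 (by simpa using hn)
  rw [append_assoc] at h hn
  rw [append_assoc] at h
  have hyA : ∃ y ∈ A, y ∈ Y := by
    rcases append_eq_append_iff.1 h with ⟨r, hr, -⟩ | ⟨r, hr, hr'⟩
    · simp [hr] at hlt
    · have hr0 : r ≠ [] := by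
        rintro rfl
        simp [hr] at hlt
      obtain ⟨y, hy, hy'⟩ := exists_mem_of_append_eq_append hr'.symm hr0 hY0
      exact ⟨y, hr ▸ mem_append_right _ hy, hy'⟩
  -- The same argument, with the second word read from right to left.
  have hzA : ∃ z ∈ A', z ∈ Z' := by
    have h2 : A'.reverse ++ (B' ++ C').reverse = X'.reverse ++ (Z'.reverse ++ Y'.reverse) := by
      simpa using congrArg List.reverse h'
    rcases append_eq_append_iff.1 h2 with ⟨r, hr, -⟩ | ⟨r, hr, hr'⟩
    · have := congrArg List.length hr
      simp [← hA.length_eq, ← hX.length_eq] at this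
      omega
    · have hr0 : r ≠ [] := by
        rintro rfl
        have := congrArg List.length hr
        simp [← hA.length_eq, ← hX.length_eq] at this
        omega
      obtain ⟨z, hz, hz'⟩ := exists_mem_of_append_eq_append hr'.symm hr0
        (by simpa using fun h : Z' = [] => hZ0 (perm_nil.1 (h ▸ hZ)))
      have hz'' : z ∈ A'.reverse := by
        rw [hr]
        exact mem_append_right _ hz
      exact ⟨z, mem_reverse.1 hz'', mem_reverse.1 hz'⟩
  obtain ⟨y, hyA, hyY⟩ := hyA
  obtain ⟨z, hzA, hzZ⟩ := hzA
  rw [← append_assoc X] at h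
  have h1 : X ++ Y ⊆ A := subset_of_append_eq_append h hn (hA.mem_iff.2 hzA) (hZ.mem_iff.2 hzZ)
  rw [append_assoc Y'] at h'
  have h2 : Z' ++ X' ⊆ A' := subset_of_append_eq_append' h' hn' (hA.mem_iff.1 hyA)
    (hY.mem_iff.1 hyY)
  obtain ⟨b, hb⟩ := exists_mem_of_ne_nil B hB0
  have h3 : b ∈ A := by
    have : b ∈ X ++ Y ++ Z := h ▸ mem_append_right A (mem_append_left C hb)
    rcases mem_append.1 this with hb | hb
    · exact h1 hb
    · exact hA.mem_iff.2 (h2 (mem_append_left _ (hZ.mem_iff.1 hb)))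
  exact (nodup_append.1 hn).2.2 b h3 b (mem_append_left C hb) rfl

end List

/-! ### Terms with equal linear orders are equivalent -/

namespace C3Term

open OpTerm

variable {G : Type v} [Group G] {V : Type w} {ρ : G →* Perm (Fin 3)}

/-- The term obtained by substituting `e` for the variables outside `p`. -/
def restrict (p : V → Bool) (t : C3Term G V) : C3Term G V :=
  t.bind fun v => bif p v then var v else e

theorem ord_restrict (p : V → Bool) (b : G) (t : C3Term G V) :
    ord ρ b (restrict p t) = (ord ρ b t).filter p := by
  simp only [restrict, ord, ord_bind]
  induction OpTerm.ord (C3Gen.rep ρ) b t with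
  | nil => rfl
  | cons v l ih =>
    rw [List.flatMap_cons, ih, List.filter_cons]
    cases p v <;> rfl

theorem ord_var (b : G) (v : V) : ord ρ b (var v) = [v] := rfl

theorem ord_length (b : G) (t : C3Term G V) : (ord ρ b t).length = (ord ρ 1 t).length :=
  (ord_perm _ _ _ t).length_eq

theorem ord_nodup {t : C3Term G V} (h : (ord ρ 1 t).Nodup) (b : G) : (ord ρ b t).Nodup :=
  (ord_perm _ _ _ t).nodup_iff.1 h

theorem ord_ne_nil {t : C3Term G V} (h : ord ρ 1 t ≠ []) (b : G) : ord ρ b t ≠ [] :=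
  fun h' => h (List.perm_nil.1 (h' ▸ ord_perm (C3Gen.rep ρ) 1 b t))

theorem ord_one_bin (hρ : IsCyclic ρ) (d : C3Bin) (s t : C3Term G V) :
    ord ρ 1 (bin d s t) = ord ρ 1 s ++ ord ρ 1 t := by
  rw [ord_bin hρ, map_one, C3Bin.sgn_one, if_pos rfl]

theorem ord_one_box (s t r : C3Term G V) :
    ord ρ 1 (box s t r) = ord ρ 1 s ++ ord ρ 1 t ++ ord ρ 1 r :=
  ord_box_of_eq_one (map_one ρ) s t r

/-- At `1` both operations keep the order, so `s` lies in `s'` and is disjoint from `t'`. If the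
signs differ at `b`, either `s` and `t'` begin the same word and share a letter, or `s'` begins and
`s` ends it, and `s'` fills the whole word, leaving nothing for `t'`. -/
theorem sgn_eq_of_ord_eq (hρ : IsCyclic ρ) {d d' : C3Bin} {s t s' t' : C3Term G V}
    (hn : (ord ρ 1 (bin d s t)).Nodup)
    (h : ∀ b, ord ρ b (bin d s t) = ord ρ b (bin d' s' t')) (hs : ord ρ 1 s ≠ [])
    (ht' : ord ρ 1 t' ≠ []) (hle : (ord ρ 1 s).length ≤ (ord ρ 1 s').length) (b : G) : d.sgn (ρ b) = d'.sgn (ρ b) := by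
  have h1 := h 1
  rw [h1] at hn
  rw [ord_one_bin hρ, ord_one_bin hρ] at h1
  rw [ord_one_bin hρ] at hn
  have hss : ord ρ 1 s ⊆ ord ρ 1 s' :=
    (List.prefix_of_prefix_length_le ⟨_, h1⟩ ⟨_, rfl⟩ hle).subset
  have hdisj : ∀ v ∈ ord ρ b s, v ∉ ord ρ b t' := fun v hv hv' =>
    (List.nodup_append.1 hn).2.2 v (hss ((ord_perm _ _ _ s).mem_iff.1 hv)) v
      ((ord_perm _ _ _ t').mem_iff.1 hv') rfl
  have hb := h b
  rw [ord_bin hρ, ord_bin hρ] at hb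
  cases hd : d.sgn (ρ b) <;> cases hd' : d'.sgn (ρ b) <;>
    simp only [hd, hd', if_true, Bool.false_eq_true, if_false] at hb <;> try rfl
  · obtain ⟨v, hv⟩ := List.exists_mem_of_ne_nil _ (ord_ne_nil hs b)
    have hn' : (ord ρ b s' ++ ord ρ b t').Nodup :=
      ((ord_perm _ _ _ s').append (ord_perm _ _ _ t')).nodup_iff.1 hn
    have h2 := List.subset_of_append_eq_append hb.symm hn'
      ((ord_perm _ _ _ s').mem_iff.1 (hss ((ord_perm _ _ _ s).mem_iff.1 hv))) hv
    obtain ⟨x, hx⟩ := List.exists_mem_of_ne_nil _ (ord_ne_nil ht' b)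
    have hx' : x ∈ ord ρ b t ++ ord ρ b s := hb ▸ List.mem_append_right _ hx
    rcases List.mem_append.1 hx' with hx' | hx'
    · exact absurd rfl ((List.nodup_append.1 hn').2.2 x (h2 hx') x hx)
    · exact absurd hx (hdisj x hx')
  · obtain ⟨v, hv, hv'⟩ := List.exists_mem_of_append_eq_append hb (ord_ne_nil hs b)
      (ord_ne_nil ht' b)
    exact absurd hv' (hdisj v hv)

/-- Two terms without repeated variables are equivalent if they have fewer than `n` variables and
determine the same linear orders. -/
def OrdFaithful (ρ : G →* Perm (Fin 3)) (V : Type w) (n : ℕ) : Prop :=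
  ∀ s t : C3Term G V, (ord ρ 1 s).length < n → (ord ρ 1 s).Nodup →
    (∀ b, ord ρ b s = ord ρ b t) → Equi ρ s t

/-- With `m` the part of `s'` outside `s`, induction gives `s' ~ d(s, m)` and `t ~ d(m, t')`, so
both sides are bracketings of `s`, `m`, `t'`. -/
theorem equi_bin_bin (hρ : IsCyclic ρ) (hg : ∃ g, ρ g = cycle₃) {d d' : C3Bin}
    {s t s' t' : C3Term G V} (ih : OrdFaithful ρ V (ord ρ 1 (bin d s t)).length)
    (hn : (ord ρ 1 (bin d s t)).Nodup)
    (h : ∀ b, ord ρ b (bin d s t) = ord ρ b (bin d' s' t')) (hs : ord ρ 1 s ≠ [])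
    (ht' : ord ρ 1 t' ≠ []) (hle : (ord ρ 1 s).length ≤ (ord ρ 1 s').length) :
    Equi ρ (bin d s t) (bin d' s' t') := by
  classical
  have hsgn := sgn_eq_of_ord_eq hρ hn h hs ht' hle
  obtain rfl : d = d' := by
    obtain ⟨g, hg⟩ := hg
    have h1 := hsgn g
    have h2 := hsgn (g * g)
    rw [map_mul, hg] at h2
    rw [hg] at h1
    exact C3Bin.ext_sgn h1 h2
  -- `restrict p s'` is the middle piece. It has no variables when `s` and `s'` have equal lengths,
  -- so that case needs no separate treatment.
  set p : V → Bool := fun v => v ∉ ord ρ 1 s with hp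
  have hfilter : ∀ b, (ord ρ b s).filter p = [] := fun b => by
    simp only [List.filter_eq_nil_iff, hp, decide_not, Bool.not_eq_true', decide_eq_false_iff_not,
      not_not]
    exact fun v hv => (ord_perm _ _ _ s).mem_iff.1 hv
  have hn' : ∀ b, (ord ρ b (bin d s' t')).Nodup := fun b => (h b) ▸ ord_nodup hn b
  have hdisj : ∀ (b : G) (k : List V), (∀ v ∈ k, ∀ w ∈ ord ρ b s, v ≠ w) → k.filter p = k := fun b k hk => by
    rw [List.filter_eq_self]
    simp only [hp, decide_eq_true_eq]
    exact fun v hv hv' => hk v hv v ((ord_perm _ _ _ s).mem_iff.1 hv') rfl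
  have hlen : ∀ b, (ord ρ b s).length ≤ (ord ρ b s').length := fun b => by
    rwa [ord_length b, ord_length b]
  have key : ∀ b, ord ρ b s' = ord ρ b (bin d s (restrict p s')) ∧
      ord ρ b t = ord ρ b (bin d (restrict p s') t') := by
    intro b
    have hb := h b
    have hnb := hn' b
    rw [ord_bin hρ] at hnb
    simp only [ord_bin hρ, ord_restrict] at hb ⊢
    split_ifs at hb hnb ⊢ with hd
    · rcases List.append_eq_append_iff.1 hb with ⟨k, hk, hk'⟩ | ⟨k, hk, hk'⟩
      · rw [hk] at hnb ⊢
        rw [List.filter_append, hfilter, hdisj b k]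
        · exact ⟨rfl, hk'⟩
        · intro v hv w hw
          exact ((List.nodup_append.1 (List.nodup_append.1 hnb).1).2.2 w hw v hv).symm
      -- Here `s` would extend `s'`, so the inequality of lengths leaves only equality.
      · have : k = [] := by
          have h1 := hlen b
          rw [hk, List.length_append] at h1
          exact List.length_eq_zero_iff.1 (by omega)
        subst this
        simp only [List.append_nil, List.nil_append] at hk hk'
        rw [← hk, hfilter]
        simp [hk']
    · rcases List.append_eq_append_iff.1 hb with ⟨k, hk, hk'⟩ | ⟨k, hk, hk'⟩
      · have : k = [] := by
          have h1 := hlen b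
          rw [hk', List.length_append] at h1
          exact List.length_eq_zero_iff.1 (by omega)
        subst this
        simp only [List.append_nil, List.nil_append] at hk hk'
        rw [← hk', hfilter]
        simp [hk]
      · rw [hk'] at hnb ⊢
        rw [List.filter_append, hfilter, hdisj b k]
        · simp [hk]
        · intro v hv w hw
          exact (List.nodup_append.1 (List.nodup_append.1 hnb).2.1).2.2 v hv w hw
  have hn1 := hn' 1
  have hl1 := congrArg List.length (h 1)
  rw [ord_one_bin hρ] at hn1
  rw [ord_one_bin hρ, ord_one_bin hρ, List.length_append, List.length_append] at hl1
  have hs0 := List.length_pos_iff.2 hs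
  have ht0 := List.length_pos_iff.2 ht'
  rw [ord_one_bin hρ] at hn ih
  rw [List.length_append] at ih
  have e1 : Equi ρ s' (bin d s (restrict p s')) :=
    ih _ _ (by omega) (List.nodup_append.1 hn1).1 fun b => (key b).1
  have e2 : Equi ρ t (bin d (restrict p s') t') :=
    ih _ _ (by omega) (List.nodup_append.1 hn).2.1 fun b => (key b).2
  exact ((Equi.bin d (.refl s) e2).trans (Equi.assoc d _ _ _).symm).trans
    (Equi.bin d e1 (.refl t')).symm

/-- Among the signs at `1`, `g`, `g * g` two agree. At those two elements the cut has the same first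
piece, while the three blocks differ by a rotation, contrary to `append_ne_of_rotate`. -/
theorem bin_ne_box (hρ : IsCyclic ρ) (hg : ∃ g, ρ g = cycle₃) {d : C3Bin}
    {s t x y z : C3Term G V} (hn : (ord ρ 1 (bin d s t)).Nodup)
    (h : ∀ b, ord ρ b (bin d s t) = ord ρ b (box x y z)) (hs : ord ρ 1 s ≠ [])
    (ht : ord ρ 1 t ≠ []) (hx : ord ρ 1 x ≠ []) (hy : ord ρ 1 y ≠ []) (hz : ord ρ 1 z ≠ []) :
    False := by
  obtain ⟨g, hg⟩ := hg
  have hg2 : ρ (g * g) = cycle₃ * cycle₃ := by rw [map_mul, hg]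
  have h0 := h 1
  have h1 := h g
  have h2 := h (g * g)
  have n1 := ord_nodup hn g
  rw [ord_one_bin hρ] at h0 hn
  rw [ord_one_box] at h0
  rw [ord_bin hρ, hg] at h1 n1
  rw [ord_bin hρ, hg2] at h2
  rw [ord_box_of_eq_cycle hg] at h1
  rw [ord_box_of_eq_cycle_sq hg2] at h2
  have P : ∀ (b c : G) (t : C3Term G V), (ord ρ b t).Perm (ord ρ c t) := fun b c t =>
    ord_perm _ _ _ t
  split_ifs at h1 n1 with hd
  · exact List.append_ne_of_rotate n1 h1 h0 (P _ _ _) (P _ _ _) (P _ _ _) (P _ _ _) (P _ _ _)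
      (ord_ne_nil hs _) (ord_ne_nil ht _) (ord_ne_nil hz _) (ord_ne_nil hx _)
  · split_ifs at h2 with hd'
    · exact List.append_ne_of_rotate hn h0 h2 (P _ _ _) (P _ _ _) (P _ _ _) (P _ _ _) (P _ _ _)
        hs ht hx hy
    · exact List.append_ne_of_rotate (((P _ _ _).append (P _ _ _)).nodup_iff.1 n1) h2 h1
        (P _ _ _) (P _ _ _) (P _ _ _) (P _ _ _) (P _ _ _)
        (ord_ne_nil ht _) (ord_ne_nil hs _) (ord_ne_nil hy _) (ord_ne_nil hz _)

/-- Each of the three blocks is first at one group element and last at another, which is the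
situation of `length_le_of_rotate`. Equality of lengths follows by exchanging the two terms. -/
theorem length_eq_of_ord_box_eq (hg : ∃ g, ρ g = cycle₃) {x y z x' y' z' : C3Term G V}
    (hn : (ord ρ 1 (box x y z)).Nodup)
    (h : ∀ b, ord ρ b (box x y z) = ord ρ b (box x' y' z'))
    (hx : ord ρ 1 x ≠ []) (hy : ord ρ 1 y ≠ []) (hz : ord ρ 1 z ≠ [])
    (hx' : ord ρ 1 x' ≠ []) (hy' : ord ρ 1 y' ≠ []) (hz' : ord ρ 1 z' ≠ []) :
    (ord ρ 1 x).length ≤ (ord ρ 1 x').length ∧ (ord ρ 1 y).length ≤ (ord ρ 1 y').length ∧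
      (ord ρ 1 z).length ≤ (ord ρ 1 z').length := by
  obtain ⟨g, hg⟩ := hg
  have hg2 : ρ (g * g) = cycle₃ * cycle₃ := by rw [map_mul, hg]
  have h0 := h 1
  have h1 := h g
  have h2 := h (g * g)
  have n1 := ord_nodup hn g
  have n2 := ord_nodup hn (g * g)
  rw [ord_one_box] at hn h0
  rw [ord_one_box] at h0
  rw [ord_box_of_eq_cycle hg] at h1 n1
  rw [ord_box_of_eq_cycle hg] at h1
  rw [ord_box_of_eq_cycle_sq hg2] at h2 n2
  rw [ord_box_of_eq_cycle_sq hg2] at h2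
  have P : ∀ (b c : G) (t : C3Term G V), (ord ρ b t).Perm (ord ρ c t) := fun b c t =>
    ord_perm _ _ _ t
  refine ⟨?_, ?_, ?_⟩
  · exact List.length_le_of_rotate hn h0 h2 (P _ _ _) (P _ _ _) (P _ _ _) (P _ _ _) (P _ _ _)
      (P _ _ _) hy hy' hz'
  · rw [← ord_length (g * g) y, ← ord_length (g * g) y']
    exact List.length_le_of_rotate n2 h2 h1 (P _ _ _) (P _ _ _) (P _ _ _) (P _ _ _) (P _ _ _)
      (P _ _ _) (ord_ne_nil hz _) (ord_ne_nil hz' _) (ord_ne_nil hx' _)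
  · rw [← ord_length g z, ← ord_length g z']
    exact List.length_le_of_rotate n1 h1 h0 (P _ _ _) (P _ _ _) (P _ _ _) (P _ _ _) (P _ _ _)
      (P _ _ _) (ord_ne_nil hx _) (ord_ne_nil hx' _) (ord_ne_nil hy' _)

theorem equi_box_box (hρ : IsCyclic ρ) (hg : ∃ g, ρ g = cycle₃) {x y z x' y' z' : C3Term G V}
    (ih : OrdFaithful ρ V (ord ρ 1 (box x y z)).length) (hn : (ord ρ 1 (box x y z)).Nodup)
    (h : ∀ b, ord ρ b (box x y z) = ord ρ b (box x' y' z'))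
    (hx : ord ρ 1 x ≠ []) (hy : ord ρ 1 y ≠ []) (hz : ord ρ 1 z ≠ [])
    (hx' : ord ρ 1 x' ≠ []) (hy' : ord ρ 1 y' ≠ []) (hz' : ord ρ 1 z' ≠ []) :
    Equi ρ (box x y z) (box x' y' z') := by
  obtain ⟨lx, ly, lz⟩ := length_eq_of_ord_box_eq hg hn h hx hy hz hx' hy' hz'
  obtain ⟨lx', ly', lz'⟩ := length_eq_of_ord_box_eq hg (h 1 ▸ hn) (fun b => (h b).symm)
    hx' hy' hz' hx hy hz
  have ex : ∀ b, (ord ρ b x).length = (ord ρ b x').length := fun b => by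
    rw [ord_length b, ord_length b, lx.antisymm lx']
  have ey : ∀ b, (ord ρ b y).length = (ord ρ b y').length := fun b => by
    rw [ord_length b, ord_length b, ly.antisymm ly']
  have ez : ∀ b, (ord ρ b z).length = (ord ρ b z').length := fun b => by
    rw [ord_length b, ord_length b, lz.antisymm lz']
  have key : ∀ b, ord ρ b x = ord ρ b x' ∧ ord ρ b y = ord ρ b y' ∧ ord ρ b z = ord ρ b z' := by
    intro b
    have hb := h b
    rcases hρ b with e | e | e
    · rw [ord_box_of_eq_one e, ord_box_of_eq_one e, List.append_assoc, List.append_assoc] at hb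
      obtain ⟨h1, h2⟩ := List.append_inj hb (ex b)
      exact ⟨h1, List.append_inj h2 (ey b)⟩
    · rw [ord_box_of_eq_cycle e, ord_box_of_eq_cycle e, List.append_assoc, List.append_assoc] at hb
      obtain ⟨h1, h2⟩ := List.append_inj hb (ez b)
      obtain ⟨h2, h3⟩ := List.append_inj h2 (ex b)
      exact ⟨h2, h3, h1⟩
    · rw [ord_box_of_eq_cycle_sq e, ord_box_of_eq_cycle_sq e, List.append_assoc,
        List.append_assoc] at hb
      obtain ⟨h1, h2⟩ := List.append_inj hb (ey b)
      obtain ⟨h2, h3⟩ := List.append_inj h2 (ez b)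
      exact ⟨h3, h1, h2⟩
  rw [ord_one_box] at hn ih
  simp only [List.length_append] at ih
  have hn1 := List.nodup_append.1 hn
  have hn2 := List.nodup_append.1 hn1.1
  have px := List.length_pos_iff.2 hx
  have py := List.length_pos_iff.2 hy
  have pz := List.length_pos_iff.2 hz
  exact .box (ih _ _ (by omega) hn2.1 fun b => (key b).1)
    (ih _ _ (by omega) hn2.2.1 fun b => (key b).2.1)
    (ih _ _ (by omega) hn1.2.1 fun b => (key b).2.2)

theorem Reduced.equi (hρ : IsCyclic ρ) (hg : ∃ g, ρ g = cycle₃) {s t : C3Term G V}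
    (hs : Reduced ρ s) (ht : Reduced ρ t) (ih : OrdFaithful ρ V (ord ρ 1 s).length)
    (hn : (ord ρ 1 s).Nodup) (h : ∀ b, ord ρ b s = ord ρ b t) : Equi ρ s t := by
  have hl := congrArg List.length (h 1)
  cases hs with
  | e =>
    rw [ht.eq_e hρ (h 1).symm]
    exact .refl _
  | var v =>
    cases ht with
    | e => simp [ord_var, ord_e] at hl
    | var w =>
      obtain rfl : v = w := by simpa [ord_var] using h 1
      exact .refl _
    | bin d h1 h2 =>
      have := List.length_pos_iff.2 h1
      have := List.length_pos_iff.2 h2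
      rw [ord_one_bin hρ, List.length_append, ord_var,
        List.length_singleton] at hl
      omega
    | box h1 h2 h3 =>
      have := List.length_pos_iff.2 h1
      have := List.length_pos_iff.2 h2
      rw [ord_one_box, List.length_append, List.length_append, ord_var,
        List.length_singleton] at hl
      omega
  | @bin d s t h1 h2 =>
    cases ht with
    | e =>
      have := List.length_pos_iff.2 h1
      rw [ord_one_bin hρ, List.length_append, ord_e, List.length_nil] at hl
      omega
    | var w =>
      have := List.length_pos_iff.2 h1
      have := List.length_pos_iff.2 h2
      rw [ord_one_bin hρ, List.length_append, ord_var,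
        List.length_singleton] at hl
      omega
    | @bin d' s' t' h1' h2' =>
      -- The situation is symmetric, so the shorter first argument may be taken as `s`.
      rcases le_total (ord ρ 1 s).length (ord ρ 1 s').length with hle | hle
      · exact equi_bin_bin hρ hg ih hn h h1 h2' hle
      · exact (equi_bin_bin hρ hg (hl ▸ ih) (h 1 ▸ hn) (fun b => (h b).symm) h1' h2 hle).symm
    | box h1' h2' h3' => exact (bin_ne_box hρ hg hn h h1 h2 h1' h2' h3').elim
  | box h1 h2 h3 =>
    cases ht with
    | e =>
      have := List.length_pos_iff.2 h1
      rw [ord_one_box, List.length_append, List.length_append, ord_e, List.length_nil] at hl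
      omega
    | var w =>
      have := List.length_pos_iff.2 h1
      have := List.length_pos_iff.2 h2
      rw [ord_one_box, List.length_append, List.length_append, ord_var,
        List.length_singleton] at hl
      omega
    | bin d h1' h2' =>
      exact (bin_ne_box hρ hg (h 1 ▸ hn) (fun b => (h b).symm) h1' h2' h1 h2 h3).elim
    | box h1' h2' h3' => exact equi_box_box hρ hg ih hn h h1 h2 h3 h1' h2' h3'

theorem ordFaithful (hρ : IsCyclic ρ) (hg : ∃ g, ρ g = cycle₃) (n : ℕ) : OrdFaithful ρ V n := by
  induction n with
  | zero => exact fun s t h => absurd h (Nat.not_lt_zero _)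
  | succ n ih =>
    intro s t hl hn h
    obtain ⟨s', hs, hs'⟩ := reducible hρ s
    obtain ⟨t', ht, ht'⟩ := reducible hρ t
    rw [hs.ord_eq hρ] at hl hn
    refine hs.trans (.trans ?_ ht.symm)
    -- Reduction preserves the number of variables, which is at most `n`, so terms with strictly
    -- fewer fall under `ih`.
    refine hs'.equi hρ hg ht' (fun x y hx => ih x y (by omega)) hn fun b => ?_
    rw [← hs.ord_eq hρ, ← ht.ord_eq hρ, h]

/-- Terms without repeated variables that determine the same linear orders are equivalent. -/
theorem equi_of_ord_eq (hρ : IsCyclic ρ) (hg : ∃ g, ρ g = cycle₃) {s t : C3Term G V}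
    (hn : (ord ρ 1 s).Nodup) (h : ∀ b, ord ρ b s = ord ρ b t) : Equi ρ s t :=
  ordFaithful hρ hg _ s t (Nat.lt_succ_self _) hn h

end C3Term

/-! ### The presentation and the equational theory -/

namespace freeOperad

variable {G : Type v} [Group G] {S : ℕ → Type u}

theorem toTerm_comp₂ (f : (freeOperad G S).obj 2) {i j : ℕ} (a : (freeOperad G S).obj i)
    (b : (freeOperad G S).obj j) :
    toTerm ((freeOperad G S).comp₂ f a b) =
      (toTerm f).bind ![(toTerm a).map (Fin.castAdd j), (toTerm b).map (Fin.natAdd i)] := by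
  rw [GOperad.comp₂, toTerm_castArity, toTerm_comp, OpTerm.bind_map]
  refine congrArg _ (funext fun x => (OpTerm.map_map _ _ _).trans ?_)
  match x with
  | 0 =>
    refine congrArg (fun f => (toTerm a).map f) (funext fun y => Fin.ext ?_)
    exact (finSigma_val (k := ![i, j]) 0 y).trans (by simp; rfl)
  | 1 =>
    refine congrArg (fun f => (toTerm b).map f) (funext fun y => Fin.ext ?_)
    exact (finSigma_val (k := ![i, j]) 1 y).trans (by simp; rfl)

theorem toTerm_comp₃ (f : (freeOperad G S).obj 3) {i j k : ℕ} (a : (freeOperad G S).obj i)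
    (b : (freeOperad G S).obj j) (c : (freeOperad G S).obj k) :
    toTerm ((freeOperad G S).comp₃ f a b c) =
      (toTerm f).bind ![(toTerm a).map fun x => Fin.castAdd k (Fin.castAdd j x),
        (toTerm b).map fun x => Fin.castAdd k (Fin.natAdd i x),
        (toTerm c).map (Fin.natAdd (i + j))] := by
  rw [GOperad.comp₃, toTerm_castArity, toTerm_comp, OpTerm.bind_map]
  refine congrArg _ (funext fun x => (OpTerm.map_map _ _ _).trans ?_)
  match x with
  | 0 =>
    refine congrArg (fun f => (toTerm a).map f) (funext fun y => Fin.ext ?_)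
    exact (finSigma_val (k := ![i, j, k]) 0 y).trans (by simp; rfl)
  | 1 =>
    refine congrArg (fun f => (toTerm b).map f) (funext fun y => Fin.ext ?_)
    exact (finSigma_val (k := ![i, j, k]) 1 y).trans (by simp; rfl)
  | 2 =>
    refine congrArg (fun f => (toTerm c).map f) (funext fun y => Fin.ext ?_)
    exact (finSigma_val (k := ![i, j, k]) 2 y).trans (by simp [Fin.sum_univ_succ]; rfl)

end freeOperad

/-! ### The relations of the presentation as equations between terms. -/

namespace C3Term

open OpTerm freeOperad

variable {G : Type v} [Group G] {V W : Type*}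

theorem bind_e (s : V → C3Term G W) : (e : C3Term G V).bind s = e :=
  congrArg (node _) (Subsingleton.elim _ _)

theorem bind_tensor (s : V → C3Term G W) (t r : C3Term G V) :
    (tensor t r).bind s = tensor (t.bind s) (r.bind s) := by
  refine congrArg (node _) (funext fun i => ?_)
  fin_cases i <;> rfl

theorem bind_box (s : V → C3Term G W) (t r q : C3Term G V) :
    (box t r q).bind s = box (t.bind s) (r.bind s) (q.bind s) := by
  refine congrArg (node _) (funext fun i => ?_)
  fin_cases i <;> rfl

theorem bind_bin (d : C3Bin) (s : V → C3Term G W) (t r : C3Term G V) :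
    (bin d t r).bind s = bin d (t.bind s) (r.bind s) := by
  cases d
  · exact bind_tensor s t r
  all_goals exact (bind_box s _ _ _).trans (by rw [bind_e]; rfl)

theorem map_e (f : V → W) : (e : C3Term G V).map f = e := bind_e _

theorem toTerm_e : toTerm (C3.e G) = e :=
  (toTerm_gen C3Gen.e).trans (congrArg (node _) (Subsingleton.elim _ _))

theorem toTerm_tensor : toTerm (C3.tensor G) = tensor (var 0) (var 1) := by
  refine (toTerm_gen C3Gen.tensor).trans (congrArg (node _) (funext fun i => ?_))
  fin_cases i <;> rfl

theorem toTerm_box : toTerm (C3.box G) = box (var 0) (var 1) (var 2) := by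
  refine (toTerm_gen C3Gen.box).trans (congrArg (node _) (funext fun i => ?_))
  fin_cases i <;> rfl

theorem toTerm_comp₃_box {i j k : ℕ} (a : (C3.F G).obj i) (b : (C3.F G).obj j)
    (c : (C3.F G).obj k) :
    toTerm ((C3.F G).comp₃ (C3.box G) a b c) =
      box ((toTerm a).map fun x => Fin.castAdd k (Fin.castAdd j x))
        ((toTerm b).map fun x => Fin.castAdd k (Fin.natAdd i x))
        ((toTerm c).map (Fin.natAdd (i + j))) := by
  rw [toTerm_comp₃, toTerm_box, bind_box]
  rfl

/-- The operation of the free operad given by a primitive binary operation. -/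
def binNode (G : Type v) [Group G] : C3Bin → (C3.F G).obj 2
  | .tensor => C3.tensor G
  | .box₁ => (C3.F G).comp₃ (C3.box G) (C3.e G) (C3.F G).unit (C3.F G).unit
  | .box₂ => (C3.F G).comp₃ (C3.box G) (C3.F G).unit (C3.e G) (C3.F G).unit
  | .box₃ => (C3.F G).comp₃ (C3.box G) (C3.F G).unit (C3.F G).unit (C3.e G)

theorem isBinaryNode_iff (x : (C3.F G).obj 2) :
    C3.IsBinaryNode G x ↔ ∃ d, x = binNode G d := by
  constructor
  · rintro (_ | _ | _ | _)
    exacts [⟨.tensor, rfl⟩, ⟨.box₁, rfl⟩, ⟨.box₂, rfl⟩, ⟨.box₃, rfl⟩]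
  · rintro ⟨_ | _ | _ | _, rfl⟩
    exacts [.tensor, .box₁, .box₂, .box₃]

theorem toTerm_binNode (d : C3Bin) : toTerm (binNode G d) = bin d (var 0) (var 1) := by
  cases d
  · exact toTerm_tensor
  all_goals
    refine (toTerm_comp₃_box _ _ _).trans ?_
    rw [toTerm_e, map_e]
    rfl

theorem toTerm_comp₂_binNode (d : C3Bin) {i j : ℕ} (a : (C3.F G).obj i) (b : (C3.F G).obj j) :
    toTerm ((C3.F G).comp₂ (binNode G d) a b) =
      bin d ((toTerm a).map (Fin.castAdd j)) ((toTerm b).map (Fin.natAdd i)) := by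
  rw [toTerm_comp₂, toTerm_binNode, bind_bin]
  rfl

theorem toTerm_box_unit₁ : toTerm ((C3.F G).comp₃ (C3.box G) (C3.F G).unit (C3.e G) (C3.e G)) =
    box (var (0 : Fin 1)) e e := by
  refine (toTerm_comp₃_box _ _ _).trans ?_
  rw [toTerm_e, map_e, map_e]
  rfl

theorem toTerm_box_unit₂ : toTerm ((C3.F G).comp₃ (C3.box G) (C3.e G) (C3.F G).unit (C3.e G)) =
    box e (var (0 : Fin 1)) e := by
  refine (toTerm_comp₃_box _ _ _).trans ?_
  rw [toTerm_e, map_e, map_e]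
  rfl

theorem toTerm_box_unit₃ : toTerm ((C3.F G).comp₃ (C3.box G) (C3.e G) (C3.e G) (C3.F G).unit) =
    box e e (var (0 : Fin 1)) := by
  refine (toTerm_comp₃_box _ _ _).trans ?_
  rw [toTerm_e, map_e, map_e]
  rfl

theorem toTerm_tensor_unit₁ : toTerm ((C3.F G).comp₂ (C3.tensor G) (C3.F G).unit (C3.e G)) =
    bin .tensor (var (0 : Fin 1)) e := by
  refine (toTerm_comp₂_binNode .tensor _ _).trans ?_
  rw [toTerm_e, map_e]
  rfl

theorem toTerm_tensor_unit₂ : toTerm ((C3.F G).comp₂ (C3.tensor G) (C3.e G) (C3.F G).unit) =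
    bin .tensor e (var (0 : Fin 1)) := by
  refine (toTerm_comp₂_binNode .tensor _ _).trans ?_
  rw [toTerm_e, map_e]
  rfl

theorem toTerm_assoc_left (d : C3Bin) :
    toTerm ((C3.F G).comp₂ (binNode G d) (binNode G d) (C3.F G).unit) =
      bin d (bin d (var (0 : Fin 3)) (var 1)) (var 2) := by
  refine (toTerm_comp₂_binNode d _ _).trans ?_
  rw [toTerm_binNode, OpTerm.map, bind_bin]
  rfl

theorem toTerm_assoc_right (d : C3Bin) :
    toTerm ((C3.F G).comp₂ (binNode G d) (C3.F G).unit (binNode G d)) =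
      bin d (var (0 : Fin 3)) (bin d (var 1) (var 2)) := by
  refine (toTerm_comp₂_binNode d _ _).trans ?_
  rw [toTerm_binNode, OpTerm.map, OpTerm.map, bind_bin]
  rfl

theorem toTerm_act_gen {n : ℕ} (x : C3Gen n) (σ : Perm (Fin n)) :
    toTerm ((C3.F G).act (gen x) σ) = node (1, x) fun i => var (σ.symm i) := by
  refine (toTerm_act _ σ).trans ?_
  rw [toTerm_gen]
  rfl

variable {ρ : G →* Perm (Fin 3)}

/-- The relations of the presentation hold in the equational theory. -/
theorem equi_of_rel {g : G} (hg : ρ g = cycle₃) {n : ℕ} {x y : (C3.F G).obj n}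
    (h : C3.Rel G g n x y) : Equi ρ (toTerm x) (toTerm y) := by
  cases h with
  | box_unit₁ => rw [toTerm_box_unit₁]; exact .bin_e .box₃ _
  | box_unit₂ => rw [toTerm_box_unit₂]; exact .bin_e .box₁ _
  | box_unit₃ => rw [toTerm_box_unit₃]; exact .e_bin .box₁ _
  | tensor_unit₁ => rw [toTerm_tensor_unit₁]; exact .bin_e .tensor _
  | tensor_unit₂ => rw [toTerm_tensor_unit₂]; exact .e_bin .tensor _
  | assoc d hd =>
    obtain ⟨d, rfl⟩ := (isBinaryNode_iff _).1 hd
    rw [toTerm_assoc_left, toTerm_assoc_right]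
    exact .assoc d _ _ _
  | smul_box =>
    have := Equi.smul (ρ := ρ) g C3Gen.box var
    rw [C3.box, toTerm_smul_gen, toTerm_act_gen]
    rwa [C3Gen.rep, hg] at this
  | smul_tensor =>
    rw [C3.tensor, toTerm_smul_gen, toTerm_gen]
    exact .smul g C3Gen.tensor var
  | smul_e =>
    rw [C3.e, toTerm_smul_gen, toTerm_gen]
    exact .smul g C3Gen.e var

/-- Two terms are related modulo a congruence relation on the free operad if they are obtained
from congruent operations by the same substitution of variables. -/
def CongrRel (C : GOperad.Congruence (C3.F G)) (s t : C3Term G V) : Prop :=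
  ∃ (n : ℕ) (x y : (C3.F G).obj n) (l : Fin n → V),
    C.rel n x y ∧ s = (toTerm x).map l ∧ t = (toTerm y).map l

namespace CongrRel

variable {C : GOperad.Congruence (C3.F G)}

theorem refl (t : C3Term G V) : CongrRel C t t := by
  obtain ⟨n, x, l, h⟩ := exists_toTerm_map t
  exact ⟨n, x, x, l, (C.rel n).refl x, h, h⟩

theorem symm {s t : C3Term G V} : CongrRel C s t → CongrRel C t s := by
  rintro ⟨n, x, y, l, h, hs, ht⟩
  exact ⟨n, y, x, l, (C.rel n).symm h, ht, hs⟩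

/-- The middle term is presented by two operations that differ by a permutation, which is absorbed
into the labelling. -/
theorem trans {s t r : C3Term G V} : CongrRel C s t → CongrRel C t r → CongrRel C s r := by
  rintro ⟨n, x, y, l, h, rfl, ht⟩ ⟨m, y', z, l', h', ht', rfl⟩
  obtain ⟨rfl, σ, hσ, hl⟩ := exists_act_of_map_eq (ht.symm.trans ht')
  obtain rfl : y' = (C3.F G).act y σ := hσ
  refine ⟨m, (C3.F G).act x σ, z, l', (C.rel m).trans (C.act σ h) h', ?_, rfl⟩
  rw [toTerm_act, OpTerm.map_map]
  exact congrArg (fun f => (toTerm x).map f) (funext hl)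

theorem bind {n : ℕ} {x y : (C3.F G).obj n} (h : C.rel n x y) {s t : Fin n → C3Term G V}
    (hs : ∀ i, CongrRel C (s i) (t i)) :
    CongrRel C ((toTerm x).bind s) ((toTerm y).bind t) := by
  choose k p q l hpq hs ht using hs
  -- `L` glues the labellings `l i` blockwise, so that the substituted terms come from the congruent
  -- composites of `x` with `p` and `y` with `q`.
  let L : Fin (∑ i, k i) → V := fun z => l (finSigmaFinEquiv.symm z).1 (finSigmaFinEquiv.symm z).2
  have key : ∀ (x : (C3.F G).obj n) (p : ∀ i, (C3.F G).obj (k i)),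
      (toTerm x).bind (fun i => (toTerm (p i)).map (l i)) =
        (toTerm ((C3.F G).comp x p)).map L := by
    intro x p
    rw [toTerm_comp, bind_map]
    refine congrArg _ (funext fun i => (Eq.trans (OpTerm.map_map _ _ _) ?_).symm)
    refine congrArg (fun f => (toTerm (p i)).map f) (funext fun a => ?_)
    have := finSigmaFinEquiv.symm_apply_apply (⟨i, a⟩ : Σ i, Fin (k i))
    exact congrArg (fun x : Σ i, Fin (k i) => l x.1 x.2) this
  refine ⟨_, (C3.F G).comp x p, (C3.F G).comp y q, L, C.comp h hpq, ?_, ?_⟩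
  · rw [funext hs, key]
  · rw [funext ht, key]

theorem of_rel {n : ℕ} {x y : (C3.F G).obj n} (h : C.rel n x y) {s t : C3Term G (Fin n)}
    (hs : toTerm x = s) (ht : toTerm y = t) (l : Fin n → C3Term G V) :
    CongrRel C (s.bind l) (t.bind l) :=
  hs ▸ ht ▸ bind h fun i => refl (l i)

end CongrRel

/-- The relations cover only the action of `g`; its powers follow by induction because `G` commutes
with the right action of `Σₙ`. -/
theorem rel_smul_gen {C : GOperad.Congruence (C3.F G)} {g : G} (hg : ρ g = cycle₃)
    (hG : ∀ a, a ∈ Submonoid.powers g) (hC : ∀ m x y, C3.Rel G g m x y → C.rel m x y) {n : ℕ}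
    (x : C3Gen n) (a : G) :
    C.rel n ((C3.F G).smul a (gen x)) ((C3.F G).act (gen x) (C3Gen.rep ρ n x a)) := by
  obtain ⟨k, rfl⟩ := hG a
  induction k with
  | zero =>
    simp only [pow_zero, map_one]
    rw [(C3.F G).one_smul, (C3.F G).act_one]
  | succ k ih =>
    have h1 : C.rel n ((C3.F G).smul g (gen x)) ((C3.F G).act (gen x) (C3Gen.rep ρ n x g)) := by
      cases x with
      | e =>
        rw [C3Gen.rep, MonoidHom.one_apply, (C3.F G).act_one]
        exact hC _ _ _ .smul_e
      | tensor =>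
        rw [C3Gen.rep, MonoidHom.one_apply, (C3.F G).act_one]
        exact hC _ _ _ .smul_tensor
      | box =>
        rw [C3Gen.rep, hg]
        exact hC _ _ _ .smul_box
    simp only [pow_succ, map_mul]
    rw [(C3.F G).mul_smul, (C3.F G).act_mul]
    refine (C.rel n).trans (C.smul _ h1) ?_
    rw [(C3.F G).smul_act]
    exact C.act _ ih

/-- The equational theory is contained in every congruence relation that contains the relations
of the presentation. -/
theorem Equi.congrRel {C : GOperad.Congruence (C3.F G)} {g : G} (hg : ρ g = cycle₃)
    (hG : ∀ a, a ∈ Submonoid.powers g) (hC : ∀ m x y, C3.Rel G g m x y → C.rel m x y)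
    {s t : C3Term G V} (h : Equi ρ s t) : CongrRel C s t := by
  -- The six unit laws of the three operations derived from `⊠` involve only these three terms.
  have box_unit₁ : ∀ t : C3Term G V, CongrRel C (C3Term.box t C3Term.e C3Term.e) t := fun t => by
    simpa only [bind_box, bind_e, var_bind] using
      CongrRel.of_rel (hC _ _ _ .box_unit₁) toTerm_box_unit₁ toTerm_unit fun _ => t
  have box_unit₂ : ∀ t : C3Term G V, CongrRel C (C3Term.box C3Term.e t C3Term.e) t := fun t => by
    simpa only [bind_box, bind_e, var_bind] using
      CongrRel.of_rel (hC _ _ _ .box_unit₂) toTerm_box_unit₂ toTerm_unit fun _ => t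
  have box_unit₃ : ∀ t : C3Term G V, CongrRel C (C3Term.box C3Term.e C3Term.e t) t := fun t => by
    simpa only [bind_box, bind_e, var_bind] using
      CongrRel.of_rel (hC _ _ _ .box_unit₃) toTerm_box_unit₃ toTerm_unit fun _ => t
  induction h with
  | refl t => exact .refl t
  | symm _ ih => exact ih.symm
  | trans _ _ ih ih' => exact ih.trans ih'
  | @node n a s t _ ih =>
    have := CongrRel.bind ((C.rel n).refl ((C3.F G).smul a.1 (gen a.2))) ih
    rwa [toTerm_smul_gen] at this
  | smul a x t =>
    exact CongrRel.of_rel (rel_smul_gen hg hG hC x a) (toTerm_smul_gen a x)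
      (toTerm_act_gen x _) t
  | bin_e d t =>
    cases d
    · simpa only [bind_bin, bind_e, var_bind] using
        CongrRel.of_rel (hC _ _ _ .tensor_unit₁) toTerm_tensor_unit₁ toTerm_unit fun _ => t
    exacts [box_unit₂ t, box_unit₁ t, box_unit₁ t]
  | e_bin d t =>
    cases d
    · simpa only [bind_bin, bind_e, var_bind] using
        CongrRel.of_rel (hC _ _ _ .tensor_unit₂) toTerm_tensor_unit₂ toTerm_unit fun _ => t
    exacts [box_unit₃ t, box_unit₃ t, box_unit₂ t]
  | assoc d s t r =>
    have := CongrRel.of_rel (hC _ _ _ (.assoc _ ((isBinaryNode_iff _).2 ⟨d, rfl⟩)))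
      (toTerm_assoc_left d) (toTerm_assoc_right d) ![s, t, r]
    simp only [bind_bin] at this
    exact this

/-- Congruence of operations is equivalence of terms. -/
theorem rel_of_congrRel {C : GOperad.Congruence (C3.F G)} {n : ℕ} {x y : (C3.F G).obj n}
    (h : CongrRel C (toTerm x) (toTerm y)) : C.rel n x y := by
  obtain ⟨m, x', y', l, h, hx, hy⟩ := h
  rw [← OpTerm.map_id (toTerm x)] at hx
  rw [← OpTerm.map_id (toTerm y)] at hy
  obtain ⟨rfl, σ, hσ, hl⟩ := exists_act_of_map_eq hx
  obtain rfl : x' = (C3.F G).act x σ := hσ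
  obtain ⟨_, τ, hτ, hl'⟩ := exists_act_of_map_eq hy
  obtain rfl : y' = (C3.F G).act y τ := hτ
  -- The labelling inverts both `σ` and `τ`. Hence it is a bijection, the two permutations coincide,
  -- and they can be cancelled.
  have hl0 : Function.Surjective l := fun i => ⟨_, (hl i).symm⟩
  have hl1 := Finite.injective_iff_surjective.2 hl0
  obtain rfl : σ = τ := by
    refine Equiv.symm_bijective.injective (Equiv.ext fun i => ?_)
    exact hl1 ((hl i).symm.trans (hl' i))
  have := C.act σ⁻¹ h
  rwa [← (C3.F G).act_mul, ← (C3.F G).act_mul, mul_inv_cancel, (C3.F G).act_one,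
    (C3.F G).act_one] at this

end C3Term

/-! ### Groups of order three -/

section CardThree

variable {G : Type v} [Group G]

theorem eq_one_or_eq_or_eq_mul_self (hG : Nat.card G = 3) {g : G} (hg : g ≠ 1) (a : G) :
    a = 1 ∨ a = g ∨ a = g * g := by
  have : Fact (Nat.Prime 3) := ⟨Nat.prime_three⟩
  obtain ⟨k, rfl⟩ : a ∈ Submonoid.powers g := mem_powers_of_prime_card hG hg
  have h3 : g ^ 3 = 1 := hG ▸ pow_card_eq_one'
  have : g ^ k = g ^ (k % 3) := by
    conv_lhs => rw [← Nat.div_add_mod k 3, pow_add, pow_mul, h3, one_pow, one_mul]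
  simp only [this]
  have : k % 3 < 3 := Nat.mod_lt _ (by norm_num)
  interval_cases k % 3
  · exact Or.inl (pow_zero g)
  · exact Or.inr (Or.inl (pow_one g))
  · exact Or.inr (Or.inr (pow_two g))

theorem IsNontrivialOrbit.eq_three (hG : Nat.card G = 3) {n : ℕ} {ρ : G →* Perm (Fin n)}
    (h : IsNontrivialOrbit ρ) : n = 3 := by
  have : Finite G := Nat.finite_of_card_ne_zero (by omega)
  obtain ⟨h1, h2⟩ := h
  have h0 : 0 < n := by omega
  have hle : n ≤ 3 := by
    -- An orbit has at most as many elements as the group; two elements are excluded because `Σ₂`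
    -- has no element of order three.
    have := Nat.card_le_card_of_surjective (fun a => ρ a ⟨0, h0⟩) (h2 ⟨0, h0⟩)
    rwa [hG, Nat.card_fin] at this
  by_contra h3
  obtain rfl : n = 2 := by omega
  have key : ∀ σ : Perm (Fin 2), σ ^ 3 = 1 → σ = 1 := by decide
  obtain ⟨a, ha⟩ := h2 0 1
  have h3 : a ^ 3 = 1 := hG ▸ pow_card_eq_one'
  rw [key (ρ a) (by rw [← map_pow, h3, map_one])] at ha
  exact absurd ha (by decide)

/-- The orbit map of the point `0` is a surjection between sets with three elements, so both orbits
are isomorphic to `G` acting on itself. -/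
theorem IsNontrivialOrbit.isomorphicGSets (hG : Nat.card G = 3) {ρ ρ' : G →* Perm (Fin 3)}
    (h : IsNontrivialOrbit ρ) (h' : IsNontrivialOrbit ρ') : IsomorphicGSets ρ ρ' := by
  have : Finite G := Nat.finite_of_card_ne_zero (by omega)
  have hb : ∀ {ρ : G →* Perm (Fin 3)}, IsNontrivialOrbit ρ →
      Function.Bijective fun a => ρ a 0 := fun h =>
    (Nat.bijective_iff_surjective_and_card _).2 ⟨h.2 0, by rw [hG, Nat.card_fin]⟩
  let f := Equiv.ofBijective _ (hb h)
  let f' := Equiv.ofBijective _ (hb h')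
  refine ⟨f.symm.trans f', fun a x => ?_⟩
  obtain ⟨b, rfl⟩ := f.surjective x
  have h1 : ρ a (f b) = f (a * b) := by simp [f]
  rw [h1]
  simp [f']

theorem IsCompleteOrbits.eq_of_mem (hG : Nat.card G = 3) {T : ∀ n : ℕ, Set (G →* Perm (Fin n))}
    (hT : IsCompleteOrbits T) {ρ ρ' : G →* Perm (Fin 3)} (h : ρ ∈ T 3) (h' : ρ' ∈ T 3) :
    ρ' = ρ :=
  have ho := hT.isNontrivialOrbit 3 ρ h
  (hT.existsUnique 3 ρ ho).unique
    ⟨h', ho.isomorphicGSets hG (hT.isNontrivialOrbit 3 ρ' h')⟩ ⟨h, ho.isomorphicGSets hG ho⟩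

end CardThree

/-- The kernel of a map of operads, as a congruence relation. -/
def GOperad.Hom.ker {G : Type v} [Group G] {O : GOperad.{u} G} {P : GOperad.{w} G}
    (φ : GOperad.Hom O P) : GOperad.Congruence O where
  rel n := Setoid.ker φ.toFun
  act σ h := (φ.map_act _ σ).trans ((congrArg (P.act · σ) h).trans (φ.map_act _ σ).symm)
  smul a _ _ h := (φ.map_smul a _).trans ((congrArg (P.smul a) h).trans (φ.map_smul a _).symm)
  comp {n f f' k h h'} hf hh := by
    have e : (fun i => φ.toFun (h i)) = fun i => φ.toFun (h' i) := funext hh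
    refine (φ.map_comp f h).trans (Eq.trans ?_ (φ.map_comp f' h').symm)
    rw [e, show φ.toFun f = φ.toFun f' from hf]

/-! ### The isomorphism with `Q_{C₃}` -/

namespace C3Term

open OpTerm freeOperad

variable {G : Type v} [Group G] {ρ : G →* Perm (Fin 3)} {g : G}

theorem ne_one_of_map_eq_cycle (hg : ρ g = cycle₃) : g ≠ 1 := by
  rintro rfl
  rw [map_one] at hg
  exact absurd hg (by decide)

theorem isCyclic (hG : Nat.card G = 3) (hg : ρ g = cycle₃) : IsCyclic ρ := by
  intro b
  rcases eq_one_or_eq_or_eq_mul_self hG (ne_one_of_map_eq_cycle hg) b with rfl | rfl | rfl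
  · exact Or.inl (map_one ρ)
  · exact Or.inr (Or.inl hg)
  · exact Or.inr (Or.inr (by rw [map_mul, hg]))

/-- Two operations of the free operad have the same image in `P_G` if and only if they are
congruent modulo the relations of the presentation. -/
theorem eval_eq_iff_rel (hG : Nat.card G = 3) (hg : ρ g = cycle₃) {n : ℕ}
    (x y : (C3.F G).obj n) :
    (C3.congr G g).rel n x y ↔ eval (C3Gen.rep ρ) x = eval (C3Gen.rep ρ) y := by
  have hρ := isCyclic hG hg
  constructor
  · intro h
    -- The kernel is a congruence, so only the generating relations have to be checked.
    refine h (toPG (C3Gen.rep ρ)).ker fun m x y hxy => ?_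
    exact (eval_eq_iff _ x y).2 fun b => (equi_of_rel hg hxy).ord_eq hρ b
  · intro h C hC
    have : Fact (Nat.Prime 3) := ⟨Nat.prime_three⟩
    refine rel_of_congrRel (Equi.congrRel hg (fun a => mem_powers_of_prime_card hG
      (ne_one_of_map_eq_cycle hg)) hC ?_)
    exact equi_of_ord_eq hρ ⟨g, hg⟩ (nodup_ord_toTerm _ x 1) ((eval_eq_iff _ x y).1 h)

theorem eval_binNode (hρ : IsCyclic ρ) (d : C3Bin) (b : G) :
    eval (C3Gen.rep ρ) (binNode G d) b = if d.sgn (ρ b) then 1 else swap 0 1 := by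
  apply permList_injective
  refine (permList_eval _ _ b).trans ?_
  rw [toTerm_binNode]
  refine (ord_bin hρ b d _ _).trans ?_
  split_ifs <;> rfl

/-- The primitive elements of `P_G(2)` are the images of the primitive binary operations. -/
theorem isPrimitive_iff (hG : Nat.card G = 3) (hg : ρ g = cycle₃) (f : (PG G).obj 2) :
    PG.IsPrimitive f ↔ ∃ d, f = eval (C3Gen.rep ρ) (binNode G d) := by
  have hρ := isCyclic hG hg
  constructor
  · intro h
    have key : ∀ σ : Perm (Fin 2), σ = 1 ∨ σ = swap 0 1 := by decide
    -- Primitivity fixes the value at `1`, so `f` is determined by its values at `g` and `g * g`.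
    have hf : ∀ d : C3Bin, (f : G → Perm (Fin 2)) g = (if d.sgn cycle₃ then 1 else swap 0 1) →
        (f : G → Perm (Fin 2)) (g * g) = (if d.sgn (cycle₃ * cycle₃) then 1 else swap 0 1) →
        f = eval (C3Gen.rep ρ) (binNode G d) := by
      intro d h1 h2
      funext b
      rw [eval_binNode hρ]
      rcases eq_one_or_eq_or_eq_mul_self hG (ne_one_of_map_eq_cycle hg) b with rfl | rfl | rfl
      · rw [map_one, C3Bin.sgn_one]
        exact h
      · rw [hg]
        exact h1
      · rw [map_mul, hg]
        exact h2
    simp only [C3Bin.sgn_cycle, C3Bin.sgn_cycle_sq] at hf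
    rcases key ((f : G → Perm (Fin 2)) g) with h1 | h1 <;>
      rcases key ((f : G → Perm (Fin 2)) (g * g)) with h2 | h2
    · exact ⟨.tensor, hf _ h1 h2⟩
    · exact ⟨.box₃, hf _ h1 h2⟩
    · exact ⟨.box₁, hf _ h1 h2⟩
    · exact ⟨.box₂, hf _ h1 h2⟩
  · rintro ⟨d, rfl⟩
    refine (eval_binNode hρ d 1).trans ?_
    rw [map_one, C3Bin.sgn_one, if_pos rfl]

theorem mem_QG_iff (hG : Nat.card G = 3) {T : ∀ n : ℕ, Set (G →* Perm (Fin n))}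
    (hT : IsCompleteOrbits T) (hρ : ρ ∈ T 3) {n : ℕ} (f : (PG G).obj n) :
    f ∈ ((PG G).suboperadGenerated fun n =>
      {f | ∃ ρ : G →* Perm (Fin n),
        (ρ ∈ T n ∨ (n = 0 ∨ n = 2) ∧ ρ = 1) ∧ f = PG.norm ρ}).carrier n ↔
      ∃ x : (C3.F G).obj n, eval (C3Gen.rep ρ) x = f := by
  constructor
  · intro h
    refine h (range (C3Gen.rep ρ)) ?_
    rintro m _ ⟨ρ', h | ⟨rfl | rfl, rfl⟩, rfl⟩
    · obtain rfl := (hT.isNontrivialOrbit m ρ' h).eq_three hG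
      obtain rfl := hT.eq_of_mem hG hρ h
      exact ⟨C3.box G, eval_gen _ C3Gen.box⟩
    · exact ⟨C3.e G, eval_gen _ C3Gen.e⟩
    · exact ⟨C3.tensor G, eval_gen _ C3Gen.tensor⟩
  · rintro ⟨x, rfl⟩
    refine eval_mem (C3Gen.rep ρ) (N := (PG G).suboperadGenerated _) (fun m s N hN => hN m ?_) x
    cases s with
    | e => exact ⟨1, Or.inr ⟨Or.inl rfl, rfl⟩, rfl⟩
    | tensor => exact ⟨1, Or.inr ⟨Or.inr rfl, rfl⟩, rfl⟩
    | box => exact ⟨ρ, Or.inl hρ, rfl⟩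

/-- The isomorphism from the operad presented by generators and relations to `Q_{C₃}`. -/
def isoQG (hG : Nat.card G = 3) {T : ∀ n : ℕ, Set (G →* Perm (Fin n))}
    (hT : IsCompleteOrbits T) (hρ : ρ ∈ T 3) (hg : ρ g = cycle₃) :
    GOperad.Iso (C3.congr G g).quotient (QG G T) where
  toFun {n} := Quotient.lift
    (fun x => (⟨eval (C3Gen.rep ρ) x, (mem_QG_iff hG hT hρ _).2 ⟨x, rfl⟩⟩ : (QG G T).obj n))
    fun x y h => Subtype.ext ((eval_eq_iff_rel hG hg x y).1 h)
  map_act f σ := by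
    obtain ⟨f, rfl⟩ := (C3.congr G g).exists_mk f
    exact Subtype.ext ((toPG (C3Gen.rep ρ)).map_act f σ)
  map_smul a f := by
    obtain ⟨f, rfl⟩ := (C3.congr G g).exists_mk f
    exact Subtype.ext ((toPG (C3Gen.rep ρ)).map_smul a f)
  map_unit := Subtype.ext (toPG (C3Gen.rep ρ)).map_unit
  map_comp f k h := by
    obtain ⟨f, rfl⟩ := (C3.congr G g).exists_mk f
    obtain ⟨h, rfl⟩ := (C3.congr G g).exists_mk_pi h
    refine (congrArg _ ((C3.congr G g).quotComp_mk f h)).trans ?_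
    exact Subtype.ext ((toPG (C3Gen.rep ρ)).map_comp f h)
  bijective n := by
    constructor
    · intro f f' h
      obtain ⟨x, rfl⟩ := (C3.congr G g).exists_mk f
      obtain ⟨y, rfl⟩ := (C3.congr G g).exists_mk f'
      exact Quotient.sound ((eval_eq_iff_rel hG hg x y).2 (congrArg Subtype.val h))
    · rintro ⟨f, hf⟩
      obtain ⟨x, rfl⟩ := (mem_QG_iff hG hT hρ f).1 hf
      exact ⟨(C3.congr G g).cls x, rfl⟩

end C3Term

theorem mainTheorem4 {G : Type v} [Group G] (hG : Nat.card G = 3)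
    (T : ∀ n : ℕ, Set (G →* Perm (Fin n))) (hT : IsCompleteOrbits T)
    (ρ : G →* Perm (Fin 3)) (hρ : ρ ∈ T 3)
    (g : G) (hg : ρ g = c[(0 : Fin 3), 1, 2]) :
    ∃ φ : GOperad.Iso (C3.congr G g).quotient (QG G T),
      QG.toPG (φ.toFun ((C3.congr G g).cls (C3.e G))) = PG.norm (1 : G →* Perm (Fin 0)) ∧
      QG.toPG (φ.toFun ((C3.congr G g).cls (C3.tensor G))) = PG.norm (1 : G →* Perm (Fin 2)) ∧
      QG.toPG (φ.toFun ((C3.congr G g).cls (C3.box G))) = PG.norm ρ ∧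
      ∀ f : (QG G T).obj 2, PG.IsPrimitive (QG.toPG f) ↔
        ∃ d, C3.IsBinaryNode G d ∧ f = φ.toFun ((C3.congr G g).cls d) := by
  refine ⟨C3Term.isoQG hG hT hρ hg, freeOperad.eval_gen _ C3Gen.e,
    freeOperad.eval_gen _ C3Gen.tensor, freeOperad.eval_gen _ C3Gen.box, fun f => ?_⟩
  rw [C3Term.isPrimitive_iff hG hg]
  constructor
  · rintro ⟨d, hd⟩
    exact ⟨_, (C3Term.isBinaryNode_iff _).2 ⟨d, rfl⟩, Subtype.ext hd⟩
  · rintro ⟨x, hx, rfl⟩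
    obtain ⟨d, rfl⟩ := (C3Term.isBinaryNode_iff _).1 hx
    exact ⟨d, rfl⟩
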